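/- Let $K$ be a finite or countable set, and let $\Delta(A)$ denote the set of probability measures on a finite or countable set $A$. **Repeated games.** Let $\Gamma=(K,S,T,(g_k)_{k\in K})$ with sets $S,T$ and functions $g_k:S\times T\to\mathbb R$, and let $\rho\in\Delta(K)$, $N\in\mathbb N$. In the zero-sum game $\Gamma_N(\rho)$ a state $k\in K$ is drawn according to $\rho$ and told only to player 1. At each stage $n=1,\dots,N$ the players simultaneously choose actions $s_n\in S$, $t_n\in T$, which are then announced. Strategies are maps $\sigma:K\times H\to\Delta(S)$ for player 1 and $\tau:H\to\Delta(T)$ for player 2, where $H=\bigsqcup_{n=1}^{N}(S\times T)^{n-1}$ is the set of histories; the payoff to player 1 (the loss of player 2) is $G_N(\rho,\sigma,\tau)=\mathbb E_{\rho,\sigma,\tau}\sum_{n=1}^N g_k(s_n,t_n)$. The game has value $v$ if for every $\varepsilon>0$ there are ($\varepsilon$-optimal) strategies $\sigma_\varepsilon,\tau_\varepsilon$ with $G_N(\rho,\sigma_\varepsilon,\tau)\ge v-\varepsilon$ for all $\tau$ and $G_N(\rho,\sigma,\tau_\varepsilon)\le v+\varepsilon$ for all $\sigma$; such a $v$ is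 unique and is written $v[\Gamma_N(\rho)]$. The non-revealing game $\Gamma_1^{\mathrm{NR}}(\rho)$ is $\Gamma_1(\rho)$ with player 1 restricted to strategies that do not depend on $k$. Let $\mathbf\Gamma(K)$ be the class of those $\Gamma$ with state set $K$ for which $S$ and $T$ are finite or countable, $\sup_{k,s,t}|g_k(s,t)|<\infty$, and for all $\rho\in\Delta(K)$ and $N\in\mathbb N$ the games $\Gamma_N(\rho)$ and $\Gamma_1^{\mathrm{NR}}(\rho)$ have values (that is, $\varepsilon$-optimal strategies exist for every $\varepsilon>0$), with $v[\Gamma_1^{\mathrm{NR}}(\rho)]=0$. **Maximal variation.** Let $\mathcal M^2(\rho)$ be the set of sequences $(\mu_n)_{n\ge1}$ of random probability measures on $K$, defined on an arbitrary probability space, such that $\mu_1=\rho$ and, for some sequence of random variables $x_1,x_2,\dots$ each taking at most two different values, $(\mu_n(A))_{n\ge1}$ is for every $A\subseteq K$ a martingale with respect to the filtration $\mathcal F_n=\sigma(x_1,\dots,x_{n-1})$ (so $\mathcal F_1$ is trivial). Put $$\xi_N^2(\rho)=\sup_{(\mu_n)\in\mathcal M^2(\rho)}\ \mathbb E\sum_{n=1}^N|\mu_{n+1}-\mu_n|,\qquad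 |\Phi|=\sum_{k\in K}|\Phi(\{k\})|.$$ **The game $\mathfrak G$.** Let $g_0(0,0)=-g_0(1,0)=3$, $g_0(1,1)=-g_0(0,1)=1$ and $g_1(0,0)=-g_1(1,0)=g_1(1,1)=-g_1(0,1)=2$. Let $\mathfrak G=(K,S,T,(\mathfrak g_k)_{k\in K})$, where $S$ is the set of pairs $(X,h)$ with $X\subseteq K$ finite and $h\in\{0,1\}$; $T$ is the set of pairs $(Y,f)$ with $Y\subseteq K$ finite and $f:2^Y\to\{0,1\}$; and $$\mathfrak g_k\big((X,h),(Y,f)\big)=g_{\chi(X,k)}\big(h,f(X\cap Y)\big),$$ with $\chi(X,k)=1$ if $k\in X$ and $\chi(X,k)=0$ otherwise. **Theorem.** The collection $\mathfrak G$ belongs to $\mathbf\Gamma(K)$, and for every $\rho\in\Delta(K)$ and $N\in\mathbb N$ $$v[\mathfrak G_N(\rho)]\ \ge\ \tfrac14\,\xi_N^2(\rho).$$ -/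

import Mathlib

namespace RepeatedGame

open MeasureTheory

universe u

/-! ### Repeated games with incomplete information on one side

Since all sets of states and actions are finite or countable, a probability measure is given by its
mass function: `Δ(A)` is `PMF A`. -/

/-- A collection `(K, S, T, (g_k))`: states, actions of P1, actions of P2, stage payoffs to P1. -/
structure Collection (K : Type u) where
  S : Type u
  T : Type u
  g : K → S → T → ℝ

namespace Collection

variable {K : Type u} (Γ : Collection K)

/-- Histories: the announced pairs of actions of the past stages, in chronological order. -/
abbrev Hist : Type u := List (Γ.S × Γ.T)

/-- Behavioural strategies of the informed player P1. In the `N`-stage game only the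
histories of length less than `N` are ever used. -/
abbrev Strategy1 : Type u := K → Γ.Hist → PMF Γ.S

/-- Behavioural strategies of the uninformed player P2. -/
abbrev Strategy2 : Type u := Γ.Hist → PMF Γ.T

/-- The law of the state and of the history of the first `n` stages. At each stage the two actions
are drawn independently given the state and the past history. -/
noncomputable def playLaw (ρ : PMF K) (σ : Γ.Strategy1) (τ : Γ.Strategy2) :
    ℕ → PMF (K × Γ.Hist)
  | 0 => ρ.map fun k => (k, [])
  | n + 1 => (playLaw ρ σ τ n).bind fun x =>
      (σ x.1 x.2).bind fun s => (τ x.2).bind fun t => PMF.pure (x.1, x.2 ++ [(s, t)])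

/-- The total payoff to P1 along a history when the state is `k`. -/
def totalGain (k : K) (h : Γ.Hist) : ℝ := (h.map fun p => Γ.g k p.1 p.2).sum

/-- The expected total payoff `G_N(ρ, σ, τ)` of the `N`-stage game. -/
noncomputable def payoff (ρ : PMF K) (N : ℕ) (σ : Γ.Strategy1) (τ : Γ.Strategy2) : ℝ :=
  ∑' x : K × Γ.Hist, (Γ.playLaw ρ σ τ N x).toReal * Γ.totalGain x.1 x.2

/-- The expected payoff of the non-revealing one-stage game: P1 uses strategies that do not
depend on the state. -/
noncomputable def payoffNR (ρ : PMF K) (σ : Γ.Hist → PMF Γ.S) (τ : Γ.Strategy2) : ℝ :=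
  Γ.payoff ρ 1 (fun _ => σ) τ

end Collection

/-- `v` is the value of the zero-sum game with strategy sets `A`, `B` and payoff `G`
(to the maximizing player): for every `ε > 0` both players have `ε`-optimal strategies. -/
def IsValue {A B : Type*} (G : A → B → ℝ) (v : ℝ) : Prop :=
  ∀ ε : ℝ, 0 < ε → ∃ (σ : A) (τ : B), (∀ τ', v - ε ≤ G σ τ') ∧ (∀ σ', G σ' τ ≤ v + ε)

/-- A game has at most one value. -/
theorem IsValue.unique {A B : Type*} {G : A → B → ℝ} {v w : ℝ}
    (hv : IsValue G v) (hw : IsValue G w) : v = w := by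
  have key : ∀ {a b : ℝ}, IsValue G a → IsValue G b → a ≤ b := by
    intro a b ha hb
    refine le_of_forall_pos_le_add fun ε hε => ?_
    obtain ⟨σ, -, h1, -⟩ := ha (ε / 2) (by linarith)
    obtain ⟨-, τ, -, h2⟩ := hb (ε / 2) (by linarith)
    linarith [h1 τ, h2 σ]
  exact le_antisymm (key hv hw) (key hw hv)

/-- The class `𝚪(K)` of collections with state set `K`. -/
structure InClass {K : Type u} (Γ : Collection K) : Prop where
  countable_S : Countable Γ.S
  countable_T : Countable Γ.T
  bounded : ∃ C : ℝ, ∀ k s t, |Γ.g k s t| ≤ C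
  hasValue : ∀ (ρ : PMF K) (N : ℕ), ∃ v : ℝ, IsValue (Γ.payoff ρ N) v
  valueNR : ∀ ρ : PMF K, IsValue (Γ.payoffNR ρ) 0

/-! ### Maximal variation -/

/-- The filtration generated by a sequence of random variables: the `n`-th σ-algebra is generated
by the first `n` variables `x 0, …, x (n - 1)`, so that the initial σ-algebra is trivial. -/
def pastFiltration {Ω : Type*} [mΩ : MeasurableSpace Ω] {E : Type*} [mE : MeasurableSpace E]
    (x : ℕ → Ω → E) (hx : ∀ n, Measurable (x n)) : Filtration ℕ mΩ where
  seq n := ⨆ j : ℕ, ⨆ _ : j < n, mE.comap (x j)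
  mono' _ _ hmn := iSup_mono fun _ => iSup_mono' fun hj => ⟨hj.trans_le hmn, le_rfl⟩
  le' _ := iSup_le fun j => iSup_le fun _ => (hx j).comap_le

/-- An element of `𝓜^D(ρ)`: a martingale `μ 0, μ 1, …` of random probability measures on `K` with
`μ 0 = ρ`, with respect to the filtration generated by a sequence of random variables each of which
takes at most `D` different values (these are labelled by `Fin D`). The probability
space is part of the data. -/
structure MeasureMartingale {K : Type u} (D : ℕ) (ρ : PMF K) where
  Ω : Type
  [mΩ : MeasurableSpace Ω]
  P : Measure Ω
  [isProb : IsProbabilityMeasure P]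
  x : ℕ → Ω → Fin D
  measurable_x : ∀ n, Measurable (x n)
  μ : ℕ → Ω → PMF K
  initial : ∀ ω, μ 0 ω = ρ
  martingale : ∀ A : Set K,
    Martingale (fun n ω => ((μ n ω).toOuterMeasure A).toReal) (pastFiltration x measurable_x) P

/-- The total variation `|p - q|` (total mass of the absolute value of the signed measure). -/
noncomputable def tvDist {K : Type u} (p q : PMF K) : ℝ := ∑' k, |(p k).toReal - (q k).toReal|

/-- The `N`-term variation `𝔼 ∑ |μ_{n+1} - μ_n|`, the sum being over the first `N` increments. -/
noncomputable def MeasureMartingale.variation {K : Type u} {D : ℕ} {ρ : PMF K}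
    (M : MeasureMartingale D ρ) (N : ℕ) : ℝ :=
  letI := M.mΩ
  ∫ ω, ∑ n ∈ Finset.range N, tvDist (M.μ (n + 1) ω) (M.μ n ω) ∂M.P

/-- The maximal variation `ξ_N^D(ρ)`. -/
noncomputable def maxVariation {K : Type u} (D N : ℕ) (ρ : PMF K) : ℝ :=
  ⨆ M : MeasureMartingale D ρ, M.variation N

theorem tvDist_nonneg {K : Type u} (p q : PMF K) : 0 ≤ tvDist p q :=
  tsum_nonneg fun _ => abs_nonneg _

theorem tvDist_le_two {K : Type u} (p q : PMF K) : tvDist p q ≤ 2 := by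
  have hs : ∀ r : PMF K, HasSum (fun k => (r k).toReal) 1 := fun r => by
    have h := ENNReal.hasSum_toReal (f := fun k => r k) r.tsum_coe_ne_top
    have h1 : ∑' k, (r k).toReal = 1 := by
      rw [← ENNReal.tsum_toReal_eq fun k => r.apply_ne_top k, r.tsum_coe, ENNReal.toReal_one]
    rwa [h1] at h
  have hadd := (hs p).add (hs q)
  have hle : ∀ k, |(p k).toReal - (q k).toReal| ≤ (p k).toReal + (q k).toReal := fun k => by
    rw [abs_le]
    have h1 : 0 ≤ (p k).toReal := ENNReal.toReal_nonneg
    have h2 : 0 ≤ (q k).toReal := ENNReal.toReal_nonneg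
    constructor <;> linarith
  have hsum : Summable fun k => |(p k).toReal - (q k).toReal| :=
    Summable.of_nonneg_of_le (fun _ => abs_nonneg _) hle hadd.summable
  calc tvDist p q ≤ ∑' k, ((p k).toReal + (q k).toReal) := hsum.tsum_le_tsum hle hadd.summable
    _ = 1 + 1 := hadd.tsum_eq
    _ = 2 := by norm_num

/-- The supremum that defines the maximal variation is over a bounded set. -/
theorem bddAbove_variation {K : Type u} (D N : ℕ) (ρ : PMF K) :
    BddAbove (Set.range fun M : MeasureMartingale D ρ => M.variation N) := by
  refine ⟨N * 2, ?_⟩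
  rintro _ ⟨M, rfl⟩
  letI := M.mΩ
  haveI := M.isProb
  have h : ‖M.variation N‖ ≤ (N * 2) * M.P.real Set.univ := by
    refine norm_integral_le_of_norm_le_const (Filter.Eventually.of_forall fun ω => ?_)
    rw [Real.norm_of_nonneg (Finset.sum_nonneg fun _ _ => tvDist_nonneg _ _)]
    refine (Finset.sum_le_sum fun n _ => tvDist_le_two _ _).trans ?_
    simp
  simpa using (le_abs_self _).trans h

/-- The set `𝓜^D(ρ)` is non-empty (it contains the constant martingale). -/
theorem nonempty_measureMartingale {K : Type u} (D : ℕ) (hD : 1 ≤ D) (ρ : PMF K) :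
    Nonempty (MeasureMartingale D ρ) :=
  ⟨{ Ω := Unit
     P := Measure.dirac ()
     x := fun _ _ => ⟨0, hD⟩
     measurable_x := fun _ => measurable_const
     μ := fun _ _ => ρ
     initial := fun _ => rfl
     martingale := fun A => martingale_const _ _ ((ρ.toOuterMeasure A).toReal) }⟩

/-! ### The game with anomalous value growth -/

/-- The payoffs `g_i(h, f)` of the two `2 × 2` games; P1 chooses the row `h`, P2 the column `f`. -/
def baseGame : Fin 2 → Fin 2 → Fin 2 → ℝ :=
  ![![![3, -1], ![-3, 1]],
    ![![2, -2], ![-2, 2]]]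

open Classical in
/-- `χ(X, k)`: `1` if `k ∈ X`, and `0` otherwise. -/
noncomputable def chi {K : Type u} (X : Finset K) (k : K) : Fin 2 := if k ∈ X then 1 else 0

open Classical in
/-- The collection `𝔊`: an action of P1 is a pair `(X, h)` with `X ⊆ K` finite and `h ∈ {0, 1}`;
an action of P2 is a pair `(Y, f)` with `Y ⊆ K` finite and `f : 2^Y → {0, 1}`; the payoff in the
state `k` is `g_{χ(X, k)}(h, f (X ∩ Y))`. -/
noncomputable def anomalousGame (K : Type u) : Collection K where
  S := Finset K × Fin 2
  T := Σ Y : Finset K, ({A : Finset K // A ⊆ Y} → Fin 2)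
  g k s t := baseGame (chi s.1 k) s.2 (t.2 ⟨s.1 ∩ t.1, Finset.inter_subset_right⟩)

end RepeatedGame

/-! In state `k` the action `(X, h)` earns `±(e - 1_{k ∈ X})`: the sign is given by `h`, and `e ∈
{3, -1}` by P2's reply, which does not see `h`. If the state has law `ν`, the mean is `±(e - ν(X))`.

Lower bound. To split the belief `μ` into `μ₀, μ₁` with probabilities `w₀ ≤ w₁`, P1 plays `(X, 0)`
on the branch `μ₀` and `(X, 1)` on an equal mass `w₀` of the branch `μ₁`; on the remaining mass he
plays some `X' ≠ X` with a fair `h`, which earns zero. P2's `e` cancels and the stage brings `w₀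
(μ₁(X) - μ₀(X))`, nearly `w₀ |μ₁ - μ₀| / 2` for a good finite `X`. The variation of the split is `2
w₀ w₁ |μ₁ - μ₀|`, at most four times that (`exists_strategy_of_split`). A martingale driven by
two-valued variables is a binary tree of such splits, and P1's action tells him which continuation
to follow, so the gains add up (`exists_strategy_of_tree`).

Values. In the non-revealing game P2 can randomize so that `e` averages to almost `ρ(X)`
(`isValue_payoffNR`). In the `N`-stage game P2 looks only at the trace of `X` on a finite set
carrying almost all of `ρ`; P1 then has finitely many plans, `exists_minimax` applies, and both
optimal mixtures are turned into behavioural strategies (`exists_nearly_optimal`). -/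

namespace RepeatedGame

/-! ### Expectations of bounded functions -/

section Expectation

variable {α β : Type*}

theorem hasSum_toReal (p : PMF α) : HasSum (fun a => (p a).toReal) 1 := by
  have h := ENNReal.hasSum_toReal (f := fun a => p a) p.tsum_coe_ne_top
  have h1 : ∑' a, (p a).toReal = 1 := by
    rw [← ENNReal.tsum_toReal_eq fun a => p.apply_ne_top a, p.tsum_coe, ENNReal.toReal_one]
  rwa [h1] at h

/-- The expectation of a real function under a probability mass function. -/
noncomputable def expect (p : PMF α) (f : α → ℝ) : ℝ := ∑' a, (p a).toReal * f a

theorem summable_mul_of_bounded {w f : α → ℝ} (hw : Summable w) (h0 : ∀ a, 0 ≤ w a) {C : ℝ}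
    (hf : ∀ a, |f a| ≤ C) : Summable fun a => w a * f a :=
  Summable.of_norm_bounded (g := fun a => w a * C) (hw.mul_right C) fun a => by
    rw [Real.norm_eq_abs, abs_mul, abs_of_nonneg (h0 a)]
    exact mul_le_mul_of_nonneg_left (hf a) (h0 a)

theorem summable_expect (p : PMF α) {f : α → ℝ} {C : ℝ} (hf : ∀ a, |f a| ≤ C) :
    Summable fun a => (p a).toReal * f a :=
  summable_mul_of_bounded (hasSum_toReal p).summable (fun _ => ENNReal.toReal_nonneg) hf

@[simp] theorem expect_const (p : PMF α) (c : ℝ) : expect p (fun _ => c) = c := by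
  rw [expect, tsum_mul_right, (hasSum_toReal p).tsum_eq, one_mul]

theorem expect_congr {p : PMF α} {f g : α → ℝ} (h : ∀ a ∈ p.support, f a = g a) :
    expect p f = expect p g := by
  refine tsum_congr fun a => ?_
  by_cases ha : a ∈ p.support
  · rw [h a ha]
  · rw [PMF.mem_support_iff, not_not] at ha
    simp [ha]

theorem expect_mono (p : PMF α) {f g : α → ℝ} {C D : ℝ} (hf : ∀ a, |f a| ≤ C)
    (hg : ∀ a, |g a| ≤ D) (h : ∀ a, f a ≤ g a) : expect p f ≤ expect p g :=
  (summable_expect p hf).tsum_le_tsum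
    (fun a => mul_le_mul_of_nonneg_left (h a) ENNReal.toReal_nonneg) (summable_expect p hg)

theorem expect_le (p : PMF α) {f : α → ℝ} {C c : ℝ} (hf : ∀ a, |f a| ≤ C) (h : ∀ a, f a ≤ c) :
    expect p f ≤ c := by
  simpa using expect_mono p hf (fun _ => le_refl |c|) h

theorem le_expect (p : PMF α) {f : α → ℝ} {C c : ℝ} (hf : ∀ a, |f a| ≤ C) (h : ∀ a, c ≤ f a) :
    c ≤ expect p f := by
  simpa using expect_mono p (fun _ => le_refl |c|) hf h

theorem abs_expect_le (p : PMF α) {f : α → ℝ} {C : ℝ} (hf : ∀ a, |f a| ≤ C) :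
    |expect p f| ≤ C :=
  abs_le.2 ⟨le_expect p hf fun a => (abs_le.1 (hf a)).1, expect_le p hf fun a => (abs_le.1 (hf a)).2⟩

theorem exists_le_expect (p : PMF α) {f : α → ℝ} {C : ℝ} (hf : ∀ a, |f a| ≤ C) :
    ∃ a, f a ≤ expect p f := by
  by_contra! h
  obtain ⟨a, ha⟩ := p.support_nonempty
  have hpos : 0 < (p a).toReal :=
    ENNReal.toReal_pos ((p.mem_support_iff a).1 ha) (p.apply_ne_top a)
  have := Summable.tsum_lt_tsum (f := fun a => (p a).toReal * expect p f)
    (g := fun a => (p a).toReal * f a) (i := a)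
    (fun b => mul_le_mul_of_nonneg_left (h b).le ENNReal.toReal_nonneg)
    (mul_lt_mul_of_pos_left (h a) hpos) ((hasSum_toReal p).summable.mul_right _)
    (summable_expect p hf)
  rw [tsum_mul_right, (hasSum_toReal p).tsum_eq, one_mul] at this
  exact lt_irrefl _ this

theorem expect_add (p : PMF α) {f g : α → ℝ} {C D : ℝ} (hf : ∀ a, |f a| ≤ C)
    (hg : ∀ a, |g a| ≤ D) : expect p (fun a => f a + g a) = expect p f + expect p g := by
  rw [expect, expect, expect, ← (summable_expect p hf).tsum_add (summable_expect p hg)]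
  exact tsum_congr fun a => mul_add _ _ _

theorem expect_const_mul (p : PMF α) (c : ℝ) (f : α → ℝ) :
    expect p (fun a => c * f a) = c * expect p f := by
  rw [expect, expect, ← tsum_mul_left]
  exact tsum_congr fun a => by ring

theorem expect_sum {ι : Type*} (p : PMF α) (s : Finset ι) {f : ι → α → ℝ} {C : ι → ℝ}
    (hf : ∀ i ∈ s, ∀ a, |f i a| ≤ C i) :
    expect p (fun a => ∑ i ∈ s, f i a) = ∑ i ∈ s, expect p (f i) := by
  simp only [expect, Finset.mul_sum]
  exact Summable.tsum_finsetSum fun i hi => summable_expect p (hf i hi)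

@[simp] theorem expect_pure (a : α) (f : α → ℝ) : expect (PMF.pure a) f = f a := by
  rw [expect, tsum_eq_single a fun b hb => by simp [PMF.pure_apply_of_ne _ _ hb]]
  simp

theorem expect_bind (p : PMF α) (q : α → PMF β) {f : β → ℝ} {C : ℝ} (hf : ∀ b, |f b| ≤ C) :
    expect (p.bind q) f = expect p fun a => expect (q a) f := by
  have hsum : Summable (Function.uncurry fun a b => (p a).toReal * ((q a b).toReal * f b)) := by
    let w : α × β → ℝ := fun x => (p x.1).toReal * (q x.1 x.2).toReal
    have hpos : ∀ x, 0 ≤ w x := fun x => mul_nonneg ENNReal.toReal_nonneg ENNReal.toReal_nonneg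
    have hfib : ∀ a, HasSum (fun b => w (a, b)) (p a).toReal := fun a => by
      simpa [w] using (hasSum_toReal (q a)).mul_left (p a).toReal
    have hw : Summable w := by
      rw [summable_prod_of_nonneg hpos]
      refine ⟨fun a => (hfib a).summable, ?_⟩
      simp only [(hfib _).tsum_eq]
      exact (hasSum_toReal p).summable
    have h := summable_mul_of_bounded hw hpos (f := fun x => f x.2) fun x => hf x.2
    simpa only [w, Function.uncurry_def, mul_assoc] using h
  have h1 : ∀ b, ((p.bind q) b).toReal = ∑' a, (p a).toReal * (q a b).toReal := fun b => by
    rw [PMF.bind_apply, ENNReal.tsum_toReal_eq fun a =>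
      ENNReal.mul_ne_top (p.apply_ne_top a) ((q a).apply_ne_top b)]
    simp only [ENNReal.toReal_mul]
  simp only [expect, h1, ← tsum_mul_left, ← tsum_mul_right, mul_assoc]
  rw [hsum.tsum_comm]

theorem expect_map (p : PMF α) (g : α → β) {f : β → ℝ} {C : ℝ} (hf : ∀ b, |f b| ≤ C) :
    expect (p.map g) f = expect p fun a => f (g a) := by
  rw [PMF.map, expect_bind _ _ hf]
  simp

theorem expect_comm (p : PMF α) (q : PMF β) {f : α → β → ℝ} {C : ℝ} (hf : ∀ a b, |f a b| ≤ C) :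
    (expect p fun a => expect q fun b => f a b) = expect q fun b => expect p fun a => f a b := by
  have h := congrArg (fun r => expect r (Function.uncurry f))
    (PMF.bind_comm p q fun a b => PMF.pure (a, b))
  have hf' : ∀ x, |Function.uncurry f x| ≤ C := fun x => hf x.1 x.2
  simpa [expect_bind _ _ hf'] using h

/-- Finite mixtures of probability mass functions. -/
theorem exists_mixture {ι : Type*} [Fintype ι] (c : ι → ℝ) (h0 : ∀ i, 0 ≤ c i)
    (h1 : ∑ i, c i = 1) (p : ι → PMF α) :
    ∃ q : PMF α, ∀ (f : α → ℝ) (C : ℝ), (∀ a, |f a| ≤ C) →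
      expect q f = ∑ i, c i * expect (p i) f := by
  have hs : ∑ i, ENNReal.ofReal (c i) = 1 := by
    rw [← ENNReal.ofReal_sum_of_nonneg fun i _ => h0 i, h1, ENNReal.ofReal_one]
  refine ⟨(PMF.ofFintype _ hs).bind p, fun f C hf => ?_⟩
  rw [expect_bind _ _ hf, expect, tsum_fintype]
  exact Finset.sum_congr rfl fun i _ => by rw [PMF.ofFintype_apply, ENNReal.toReal_ofReal (h0 i)]

end Expectation

/-! ### The minimax theorem -/

/-- A bounded game in which the maximizer has finitely many pure strategies has a value in mixed
strategies, with `ε`-optimal strategies for the minimizer. -/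
theorem exists_minimax {F B : Type*} [Fintype F] [Nonempty F] [Nonempty B] (G : F → B → ℝ) {C : ℝ}
    (hG : ∀ a b, |G a b| ≤ C) {ε : ℝ} (hε : 0 < ε) :
    ∃ (c : F → ℝ) (ν : PMF B), (∀ a, 0 ≤ c a) ∧ ∑ a, c a = 1 ∧
      ∀ a b, expect ν (G a) ≤ ∑ a', c a' * G a' b + ε := by
  classical
  let m : PMF B → ℝ := fun ν => Finset.univ.sup' Finset.univ_nonempty fun a => expect ν (G a)
  have hm : ∀ ν a, expect ν (G a) ≤ m ν := fun ν a =>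
    Finset.le_sup' (fun a => expect ν (G a)) (Finset.mem_univ a)
  have hbdd : BddBelow (Set.range m) := by
    refine ⟨-C, ?_⟩
    rintro _ ⟨ν, rfl⟩
    exact (abs_le.1 (abs_expect_le ν (hG (Classical.arbitrary F)))).1.trans (hm ν _)
  have : Nonempty (PMF B) := ⟨PMF.pure (Classical.arbitrary B)⟩
  set V := ⨅ ν, m ν with hV
  obtain ⟨ν, hν⟩ := exists_lt_of_ciInf_lt (f := m) (a := V + ε) (by linarith)
  have hD : Convex ℝ (Set.univ.pi fun _ : F => Set.Iio V) := convex_pi fun _ _ => convex_Iio V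
  have hDo : IsOpen (Set.univ.pi fun _ : F => Set.Iio V) :=
    isOpen_set_pi Set.finite_univ fun _ _ => isOpen_Iio
  have hE : Convex ℝ (Set.range fun (ν : PMF B) a => expect ν (G a)) := by
    rintro _ ⟨p, rfl⟩ _ ⟨q, rfl⟩ s t hs ht hst
    obtain ⟨r, hr⟩ := exists_mixture ![s, t] (fun i => by fin_cases i <;> simpa)
      (by simpa using hst) ![p, q]
    refine ⟨r, funext fun a => ?_⟩
    simp [hr (G a) C (hG a)]
  have hdisj : Disjoint (Set.univ.pi fun _ : F => Set.Iio V)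
      (Set.range fun (ν : PMF B) a => expect ν (G a)) := by
    rw [Set.disjoint_left]
    rintro _ hy ⟨p, rfl⟩
    have : m p < V := (Finset.sup'_lt_iff _).2 fun a _ => hy a trivial
    exact absurd (ciInf_le hbdd p) (not_le.2 this)
  -- The open orthant `{y < V}` misses the convex set of payoff vectors of the minimizer's mixtures.
  -- The coefficients of a separating functional, normalized, are the maximizer's mixture.
  obtain ⟨f, u, hf1, hf2⟩ := geometric_hahn_banach_open hD hDo hE hdisj
  have hlin : ∀ y : F → ℝ, f y = ∑ a, f (Pi.single a 1) * y a := fun y => by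
    conv_lhs => rw [← Finset.univ_sum_single y]
    rw [map_sum]
    refine Finset.sum_congr rfl fun a _ => ?_
    have : Pi.single a (y a) = y a • (Pi.single a 1 : F → ℝ) := by
      rw [← Pi.single_smul, smul_eq_mul, mul_one]
    rw [this, map_smul, smul_eq_mul, mul_comm]
  set l : F → ℝ := fun a => f (Pi.single a 1) with hl
  have hl0 : ∀ a, 0 ≤ l a := by
    intro a
    by_contra! hneg
    -- With a negative coefficient at `a`, `f` would exceed `u` far along `-Pi.single a 1`, without
    -- leaving the orthant.
    obtain ⟨n, hn⟩ := exists_nat_gt ((u - f fun _ => V - 1) / -l a)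
    rw [div_lt_iff₀ (neg_pos.2 hneg)] at hn
    have h := hf1 ((fun _ => V - 1) - (n : ℝ) • Pi.single a 1) fun b _ => by
      have h1 : (0 : ℝ) ≤ (Pi.single a 1 : F → ℝ) b := by
        rw [Pi.single_apply]; split_ifs <;> norm_num
      have h2 := mul_nonneg (Nat.cast_nonneg (α := ℝ) n) h1
      simp only [Pi.sub_apply, Pi.smul_apply, smul_eq_mul, Set.mem_Iio]
      linarith
    rw [map_sub, map_smul, smul_eq_mul] at h
    change _ - n * l a < u at h
    linarith
  have hsum : 0 < ∑ a, l a := by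
    refine (Finset.sum_nonneg fun a _ => hl0 a).lt_of_ne fun h0 => ?_
    have hz : ∀ a, l a = 0 := fun a =>
      (Finset.sum_eq_zero_iff_of_nonneg fun a _ => hl0 a).1 h0.symm a (Finset.mem_univ a)
    have h1 := hf1 (fun _ => V - 1) fun a _ => by simp
    have h2 := hf2 _ ⟨ν, rfl⟩
    rw [hlin] at h1 h2
    simp only [hl] at hz
    simp only [hz, zero_mul, Finset.sum_const_zero] at h1 h2
    linarith
  have hVu : (∑ a, l a) * V ≤ u := by
    refine le_of_forall_pos_le_add fun δ hδ => ?_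
    have h1 := hf1 (fun _ => V - δ / ∑ a, l a) fun a _ => by
      simpa using div_pos hδ hsum
    rw [hlin, ← Finset.sum_mul, mul_sub, mul_div_cancel₀ _ hsum.ne'] at h1
    linarith
  refine ⟨fun a => l a / ∑ a, l a, ν, fun a => div_nonneg (hl0 a) hsum.le, ?_, fun a b => ?_⟩
  · rw [← Finset.sum_div, div_self hsum.ne']
  · have h2 := hf2 _ ⟨PMF.pure b, rfl⟩
    rw [hlin] at h2
    simp only [expect_pure] at h2
    have h3 : V ≤ ∑ a', l a' / (∑ a, l a) * G a' b := by
      simp only [div_mul_eq_mul_div]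
      rw [← Finset.sum_div, le_div_iff₀ hsum]
      linarith
    linarith [hm ν a]

/-! ### Payoffs state by state, by recursion on the first stage. -/

namespace Collection

variable {K : Type*} (Γ : Collection K)

/-- The expected payoff of the `N`-stage game in the state `k`, by recursion on the first stage. -/
noncomputable def stateGain (k : K) : ℕ → (Γ.Hist → PMF Γ.S) → Γ.Strategy2 → ℝ
  | 0, _, _ => 0
  | N + 1, α, β => expect (α []) fun s => expect (β []) fun t =>
      Γ.g k s t + stateGain k N (fun h => α ((s, t) :: h)) (fun h => β ((s, t) :: h))

variable {Γ} {C : ℝ}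

theorem abs_stateGain_le (hC : ∀ k s t, |Γ.g k s t| ≤ C) (k : K) (N : ℕ)
    (α : Γ.Hist → PMF Γ.S) (β : Γ.Strategy2) : |Γ.stateGain k N α β| ≤ N * C := by
  induction N generalizing α β with
  | zero => simp [stateGain]
  | succ N ih =>
    refine abs_expect_le _ fun s => abs_expect_le _ fun t => (abs_add_le _ _).trans ?_
    have := ih (fun h => α ((s, t) :: h)) (fun h => β ((s, t) :: h))
    push_cast
    linarith [hC k s t]

theorem abs_gain_add_stateGain_le (hC : ∀ k s t, |Γ.g k s t| ≤ C) (k : K) (N : ℕ) (s : Γ.S)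
    (t : Γ.T) (α : Γ.Hist → PMF Γ.S) (β : Γ.Strategy2) :
    |Γ.g k s t + Γ.stateGain k N α β| ≤ (N + 1) * C := by
  refine (abs_add_le _ _).trans ?_
  linarith [hC k s t, abs_stateGain_le hC k N α β]

theorem abs_totalGain_le (hC : ∀ k s t, |Γ.g k s t| ≤ C) (k : K) (h : Γ.Hist) :
    |Γ.totalGain k h| ≤ h.length * C := by
  induction h with
  | nil => simp [totalGain]
  | cons p h ih =>
    simp only [totalGain, List.map_cons, List.sum_cons, List.length_cons] at ih ⊢
    refine (abs_add_le _ _).trans ?_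
    push_cast
    linarith [hC k p.1 p.2]

theorem length_eq_of_mem_support_playLaw (ρ : PMF K) (σ : Γ.Strategy1) (τ : Γ.Strategy2) (n : ℕ) :
    ∀ x ∈ (Γ.playLaw ρ σ τ n).support, x.2.length = n := by
  induction n with
  | zero =>
    intro x hx
    simp only [playLaw, PMF.support_map, Set.mem_image] at hx
    obtain ⟨k, -, rfl⟩ := hx
    rfl
  | succ n ih =>
    intro x hx
    simp only [playLaw, PMF.mem_support_bind_iff, PMF.mem_support_pure_iff] at hx
    obtain ⟨y, hy, s, -, t, -, rfl⟩ := hx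
    simp [ih y hy]

theorem payoff_eq_expect (hC : ∀ k s t, |Γ.g k s t| ≤ C) (ρ : PMF K) (N : ℕ) (σ : Γ.Strategy1)
    (τ : Γ.Strategy2) :
    Γ.payoff ρ N σ τ = expect ρ fun k => Γ.stateGain k N (σ k) τ := by
  -- `F n N` is the gain of the first `n` stages plus the expected gain of `N` more; its mean under
  -- the law of the first `n` stages depends only on `n + N`. The cut-off on the length keeps it
  -- bounded.
  let F : ℕ → ℕ → K × Γ.Hist → ℝ := fun n N x => if x.2.length = n then
    Γ.totalGain x.1 x.2 + Γ.stateGain x.1 N (fun h => σ x.1 (x.2 ++ h)) (fun h => τ (x.2 ++ h))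
    else 0
  have hF : ∀ n N x, |F n N x| ≤ (n + N) * |C| := fun n N x => by
    simp only [F]
    split_ifs with h
    · refine (abs_add_le _ _).trans ?_
      have h1 := abs_totalGain_le hC x.1 x.2
      have h2 := abs_stateGain_le hC x.1 N (fun h => σ x.1 (x.2 ++ h)) (fun h => τ (x.2 ++ h))
      rw [h] at h1
      nlinarith [mul_nonneg (n.cast_nonneg (α := ℝ)) (sub_nonneg.2 (le_abs_self C)),
        mul_nonneg (N.cast_nonneg (α := ℝ)) (sub_nonneg.2 (le_abs_self C))]
    · simp only [abs_zero]; positivity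
  have key : ∀ n N, expect (Γ.playLaw ρ σ τ n) (F n N) =
      expect ρ fun k => Γ.stateGain k (n + N) (σ k) τ := by
    intro n
    induction n with
    | zero =>
      intro N
      rw [playLaw, expect_map _ _ (hF 0 N)]
      simp [F, totalGain]
    | succ n ih =>
      intro N
      rw [show n + 1 + N = n + (N + 1) by ring, ← ih, playLaw, expect_bind _ _ (hF _ N)]
      refine expect_congr fun x hx => ?_
      have hx := length_eq_of_mem_support_playLaw ρ σ τ n x hx
      rw [expect_bind _ _ (hF _ N)]
      simp only [expect_bind _ _ (hF _ N), expect_pure]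
      simp only [F, hx, List.length_append, List.length_singleton, if_true, stateGain,
        List.append_nil, List.append_assoc, List.singleton_append, totalGain, List.map_append,
        List.sum_append, List.map_singleton, List.sum_singleton]
      have hb : ∀ s t, |Γ.g x.1 s t + Γ.stateGain x.1 N (fun h => σ x.1 (x.2 ++ (s, t) :: h))
          (fun h => τ (x.2 ++ (s, t) :: h))| ≤ (N + 1) * C := fun s t =>
        abs_gain_add_stateGain_le hC _ _ _ _ _ _
      simp only [add_assoc]
      have h1 : ∀ s, (expect (τ x.2) fun t => (List.map (fun p => Γ.g x.1 p.1 p.2) x.2).sum +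
          (Γ.g x.1 s t + Γ.stateGain x.1 N (fun h => σ x.1 (x.2 ++ (s, t) :: h))
          (fun h => τ (x.2 ++ (s, t) :: h)))) = _ := fun s =>
        expect_add _ (fun _ => le_rfl) (hb s)
      simp only [h1]
      rw [expect_add _ (fun _ => by rw [expect_const]) fun s => abs_expect_le _ (hb s)]
      simp
  have := key N 0
  rw [Nat.add_zero] at this
  rw [← this]
  refine expect_congr (f := fun x : K × Γ.Hist => Γ.totalGain x.1 x.2) fun x hx => ?_
  simp [F, length_eq_of_mem_support_playLaw ρ σ τ N x hx, stateGain]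

/-! ### Strategies of P2 that ignore his own actions -/

variable (Γ) in
/-- The payoff in the state `k` when P1 plays the sequence of actions `p` and P2's strategy depends
only on the past actions of P1. -/
noncomputable def pathGain (k : K) : ℕ → (List Γ.S → PMF Γ.T) → (ℕ → Γ.S) → ℝ
  | 0, _, _ => 0
  | N + 1, β, p => expect (β []) (Γ.g k (p 0)) +
      pathGain k N (fun z => β (p 0 :: z)) fun n => p (n + 1)

theorem abs_pathGain_le (hC : ∀ k s t, |Γ.g k s t| ≤ C) (k : K) (N : ℕ)
    (β : List Γ.S → PMF Γ.T) (p : ℕ → Γ.S) : |Γ.pathGain k N β p| ≤ N * C := by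
  induction N generalizing β p with
  | zero => simp [pathGain]
  | succ N ih =>
    refine (abs_add_le _ _).trans ?_
    have := ih (fun z => β (p 0 :: z)) fun n => p (n + 1)
    push_cast
    linarith [abs_expect_le (β []) (hC k (p 0))]

/-- P2 may see P1's actions only through `r`, which will be the trace on a finite set of states. -/
theorem pathGain_congr {k : K} {N : ℕ} {β β' : List Γ.S → PMF Γ.T} {p p' : ℕ → Γ.S}
    {r : Γ.S → Γ.S} (hp : ∀ n < N, r (p n) = p' n)
    (h : ∀ z, ∀ n < N, expect (β z) (Γ.g k (p n)) = expect (β' (z.map r)) (Γ.g k (p' n))) :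
    Γ.pathGain k N β p = Γ.pathGain k N β' p' := by
  induction N generalizing β β' p p' with
  | zero => rfl
  | succ N ih =>
    simp only [pathGain]
    rw [h [] 0 N.succ_pos, ih (p := fun n => p (n + 1)) (p' := fun n => p' (n + 1))
      (fun n hn => hp (n + 1) (by omega)) (fun z n hn => ?_)]
    · rfl
    · rw [h _ _ (by omega), List.map_cons, hp 0 N.succ_pos]

/-- P2 may redraw `x` independently at every stage: along a fixed path the gain is a sum over
stages, and each term involves only the law of P2's current action. Mixed strategies thus become
behavioural without conditioning. -/
theorem pathGain_map {B : Type*} (hC : ∀ k s t, |Γ.g k s t| ≤ C) (k : K) (N : ℕ) (ν : PMF B)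
    (b : B → List Γ.S → Γ.T) (p : ℕ → Γ.S) :
    Γ.pathGain k N (fun z => ν.map fun x => b x z) p =
      expect ν fun x => Γ.pathGain k N (fun z => PMF.pure (b x z)) p := by
  induction N generalizing b p with
  | zero => simp [pathGain]
  | succ N ih =>
    simp only [pathGain, expect_pure]
    rw [expect_add _ (fun _ => hC _ _ _) fun _ => abs_pathGain_le hC _ _ _ _,
      expect_map _ _ (hC k (p 0)), ih fun x z => b x (p 0 :: z)]

/-- P2's future play ignores his own past actions, so P1 gains nothing by observing them. -/
theorem stateGain_le_of_pathGain_le (hC : ∀ k s t, |Γ.g k s t| ≤ C) (k : K) (N : ℕ)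
    (β : List Γ.S → PMF Γ.T) (α : Γ.Hist → PMF Γ.S) {y : ℝ} (h : ∀ p, Γ.pathGain k N β p ≤ y) :
    Γ.stateGain k N α (fun h => β (h.map Prod.fst)) ≤ y := by
  induction N generalizing β α y with
  | zero =>
    obtain ⟨s, -⟩ := (α []).support_nonempty
    exact h fun _ => s
  | succ N ih =>
    have hb := fun s t => abs_gain_add_stateGain_le hC k N s t
      (fun h => α ((s, t) :: h)) fun h => β (List.map Prod.fst ((s, t) :: h))
    refine expect_le _ (fun s => abs_expect_le _ (hb s)) fun s => ?_
    rw [expect_add _ (hC k s) fun t => abs_stateGain_le hC _ _ _ _]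
    have h1 : ∀ t, Γ.stateGain k N (fun h => α ((s, t) :: h))
        (fun h => β (List.map Prod.fst ((s, t) :: h))) ≤ y - expect (β []) (Γ.g k s) := fun t =>
      ih (fun z => β (s :: z)) _ fun p => by
        let q : ℕ → Γ.S := fun n => Nat.casesOn n s p
        have : expect (β []) (Γ.g k s) + Γ.pathGain k N (fun z => β (s :: z)) p ≤ y :=
          h q
        linarith
    simp only [List.map_nil, List.map_cons] at h1 ⊢
    linarith [expect_le (β []) (fun t => abs_stateGain_le hC k N (fun h => α ((s, t) :: h))
      fun h => β (s :: List.map Prod.fst h)) h1]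

/-! ### Strategies of P1 from joint distributions of states and actions -/

/-- `π` is the law of `act i` when `i` has weight proportional to `a i`; multiplying by the total
mass admits mass zero. -/
theorem exists_conditional {ι A : Type*} [Fintype ι] [Nonempty A] (a : ι → ℝ) (h0 : ∀ i, 0 ≤ a i)
    (act : ι → A) : ∃ π : PMF A, ∀ (f : A → ℝ) (C : ℝ), (∀ x, |f x| ≤ C) →
      (∑ i, a i) * expect π f = ∑ i, a i * f (act i) := by
  rcases (Finset.sum_nonneg fun i (_ : i ∈ Finset.univ) => h0 i).eq_or_lt with hs | hs
  · refine ⟨PMF.pure (Classical.arbitrary A), fun f _ _ => ?_⟩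
    rw [← hs, zero_mul, Finset.sum_eq_zero fun i hi => ?_]
    rw [(Finset.sum_eq_zero_iff_of_nonneg fun i _ => h0 i).1 hs.symm i hi, zero_mul]
  · obtain ⟨π, hπ⟩ := exists_mixture (fun i => a i / ∑ i, a i) (fun i => div_nonneg (h0 i) hs.le)
      (by rw [← Finset.sum_div, div_self hs.ne']) fun i => PMF.pure (act i)
    refine ⟨π, fun f C hf => ?_⟩
    rw [hπ f C hf, Finset.mul_sum]
    refine Finset.sum_congr rfl fun i _ => ?_
    rw [expect_pure, ← mul_assoc, mul_div_cancel₀ _ hs.ne']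

/-- P1 can realize any joint distribution of the state and his first action, and continue according
to the action drawn. -/
theorem exists_strategy_step {ι : Type*} [Fintype ι] [Nonempty Γ.S]
    (hC : ∀ k s t, |Γ.g k s t| ≤ C) (a : ι → K → ℝ) (h0 : ∀ i k, 0 ≤ a i k) (act : ι → K → Γ.S)
    (cont : Γ.S → Γ.Strategy1) : ∃ σ : Γ.Strategy1, ∀ (k : K) (N : ℕ) (τ : Γ.Strategy2),
      (∑ i, a i k) * Γ.stateGain k (N + 1) (σ k) τ = expect (τ []) fun t =>
        ∑ i, a i k * (Γ.g k (act i k) t +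
          Γ.stateGain k N (cont (act i k) k) fun h => τ ((act i k, t) :: h)) := by
  choose π hπ using fun k => exists_conditional (fun i => a i k) (fun i => h0 i k)
    fun i => act i k
  refine ⟨fun k h => h.casesOn (π k) fun x h => cont x.1 k h, fun k N τ => ?_⟩
  have hb := fun s t => abs_gain_add_stateGain_le hC k N s t (cont s k) fun h => τ ((s, t) :: h)
  simp only [stateGain]
  rw [hπ k _ _ fun s => abs_expect_le _ (hb s), expect_sum _ _ (C := fun i => a i k * ((N + 1) * C))
    fun i _ t => by
      rw [abs_mul, abs_of_nonneg (h0 i k)]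
      exact mul_le_mul_of_nonneg_left (hb _ _) (h0 i k)]
  exact Finset.sum_congr rfl fun i _ => (expect_const_mul _ _ _).symm

/-- A mixture of state-dependent sequences of actions of P1 can be realized by a behavioural
strategy, against which strategies of P2 that depend only on the past actions of P1 are optimal. -/
theorem exists_strategy_of_mixture {ι : Type*} [Fintype ι] [Nonempty Γ.S]
    (hC : ∀ k s t, |Γ.g k s t| ≤ C) (K₀ : Finset K) (N : ℕ) (a : ι → K → ℝ)
    (h0 : ∀ i k, 0 ≤ a i k) (p : ι → K → ℕ → Γ.S) :
    ∃ σ : Γ.Strategy1, ∀ τ : Γ.Strategy2, ∃ b : List Γ.S → Γ.T,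
      ∑ k ∈ K₀, ∑ i, a i k * Γ.pathGain k N (fun z => PMF.pure (b z)) (p i k) ≤
        ∑ k ∈ K₀, (∑ i, a i k) * Γ.stateGain k N (σ k) τ := by
  classical
  induction N generalizing a p with
  | zero =>
    refine ⟨fun _ _ => PMF.pure (Classical.arbitrary _), fun τ => ?_⟩
    obtain ⟨t, -⟩ := (τ []).support_nonempty
    exact ⟨fun _ => t, by simp [pathGain, stateGain]⟩
  | succ N ih =>
    -- After a first action `s`, only the plans that begin with `s` keep their weight.
    choose cont hcont using fun s => ih (fun i k => if p i k 0 = s then a i k else 0)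
      (fun i k => by split_ifs <;> simp [h0]) fun i k n => p i k (n + 1)
    obtain ⟨σ, hσ⟩ := exists_strategy_step hC a h0 (fun i k => p i k 0) cont
    refine ⟨σ, fun τ => ?_⟩
    choose b hb using fun s t => hcont s fun h => τ ((s, t) :: h)
    have hbd : ∀ k i t, |a i k * (Γ.g k (p i k 0) t +
        Γ.stateGain k N (cont (p i k 0) k) fun h => τ ((p i k 0, t) :: h))| ≤
        a i k * ((N + 1) * C) := fun k i t => by
      rw [abs_mul, abs_of_nonneg (h0 i k)]
      exact mul_le_mul_of_nonneg_left (abs_gain_add_stateGain_le hC _ _ _ _ _ _) (h0 i k)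
    have hbd' : ∀ k t, |∑ i, a i k * (Γ.g k (p i k 0) t +
        Γ.stateGain k N (cont (p i k 0) k) fun h => τ ((p i k 0, t) :: h))| ≤
        ∑ i, a i k * ((N + 1) * C) := fun k t =>
      (Finset.abs_sum_le_sum_abs _ _).trans (Finset.sum_le_sum fun i _ => hbd k i t)
    simp only [hσ]
    rw [← expect_sum _ _ fun k _ => hbd' k]
    have hbd2 : ∀ t, |∑ k ∈ K₀, ∑ i, a i k * (Γ.g k (p i k 0) t +
        Γ.stateGain k N (cont (p i k 0) k) fun h => τ ((p i k 0, t) :: h))| ≤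
        ∑ k ∈ K₀, ∑ i, a i k * ((N + 1) * C) := fun t =>
      (Finset.abs_sum_le_sum_abs _ _).trans (Finset.sum_le_sum fun k _ => hbd' k t)
    -- At each stage `b` takes an action of P2 that costs him no more than the average under `τ`.
    obtain ⟨t, ht⟩ := exists_le_expect (τ []) hbd2
    refine ⟨fun z => z.casesOn t fun s z => b s t z, le_trans ?_ ht⟩
    simp only [pathGain, expect_pure, mul_add, Finset.sum_add_distrib]
    refine add_le_add_right ?_ _
    have hsplit : ∀ X : Γ.S → ι → K → ℝ, ∑ k ∈ K₀, ∑ i, a i k * X (p i k 0) i k =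
        ∑ s ∈ K₀.biUnion fun k => Finset.univ.image fun i => p i k 0,
          ∑ k ∈ K₀, ∑ i, (if p i k 0 = s then a i k else 0) * X s i k := fun X => by
      conv_rhs => rw [Finset.sum_comm]
      refine Finset.sum_congr rfl fun k hk => ?_
      conv_rhs => rw [Finset.sum_comm]
      refine Finset.sum_congr rfl fun i _ => ?_
      simp only [ite_mul, zero_mul]
      rw [Finset.sum_ite_eq, if_pos]
      exact Finset.mem_biUnion.2 ⟨k, hk, Finset.mem_image_of_mem _ (Finset.mem_univ i)⟩
    rw [hsplit fun s i k => Γ.pathGain k N (fun z => PMF.pure (b s t z)) fun n => p i k (n + 1),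
      hsplit fun s i k => Γ.stateGain k N (cont s k) fun h => τ ((s, t) :: h)]
    refine Finset.sum_le_sum fun s _ => ?_
    have := hb s t
    simpa only [Finset.sum_mul] using this

end Collection

/-- A bounded game has a value as soon as, for every `ε`, there is a pair of strategies that cannot
be improved on by more than `ε`. -/
theorem exists_isValue {A B : Type*} {G : A → B → ℝ}
    (h : ∀ ε : ℝ, 0 < ε → ∃ σ τ, ∀ σ' τ', G σ' τ ≤ G σ τ' + ε) : ∃ v, IsValue G v := by
  obtain ⟨σ₁, τ₁, h₁⟩ := h 1 one_pos
  -- The value is the supremum of the levels that P1 can guarantee.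
  let L : Set ℝ := {x | ∃ σ, ∀ τ, x ≤ G σ τ}
  have hL : ∀ σ τ, ∀ ε, (∀ σ' τ', G σ' τ ≤ G σ τ' + ε) → ∀ σ', G σ' τ - ε ∈ L :=
    fun σ τ ε h σ' => ⟨σ, fun τ' => by linarith [h σ' τ']⟩
  have hU : ∀ σ τ, ∀ ε, (∀ σ' τ', G σ' τ ≤ G σ τ' + ε) → ∀ x ∈ L, x ≤ G σ τ + ε := by
    rintro σ τ ε h x ⟨σ', hx⟩
    exact (hx τ).trans (h σ' τ)
  have hbdd : BddAbove L := ⟨_, hU σ₁ τ₁ 1 h₁⟩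
  refine ⟨sSup L, fun ε hε => ?_⟩
  obtain ⟨σ, τ, hστ⟩ := h (ε / 2) (by linarith)
  refine ⟨σ, τ, fun τ' => ?_, fun σ' => ?_⟩
  · have := csSup_le ⟨_, hL σ τ _ hστ σ⟩ (hU σ τ _ hστ)
    linarith [hστ σ τ']
  · have := le_csSup hbdd (hL σ τ _ hστ σ')
    linarith

variable {K : Type*}

/-! ### Finite truncations of the state set -/

theorem expect_ite_mem [DecidableEq K] (ρ : PMF K) (A : Finset K) :
    (expect ρ fun k => if k ∈ A then 1 else 0) = ∑ k ∈ A, (ρ k).toReal := by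
  rw [expect, tsum_eq_sum (s := A) fun k hk => by simp [hk]]
  exact Finset.sum_congr rfl fun k hk => by simp [hk]

theorem exists_finset_one_sub_lt (ρ : PMF K) {δ : ℝ} (hδ : 0 < δ) :
    ∃ A : Finset K, 1 - δ < ∑ k ∈ A, (ρ k).toReal :=
  ((hasSum_toReal ρ).eventually_const_lt (show 1 - δ < 1 by linarith)).exists

theorem abs_expect_sub_sum_le (ρ : PMF K) (A : Finset K) {f : K → ℝ} {C : ℝ}
    (hf : ∀ k, |f k| ≤ C) :
    |expect ρ f - ∑ k ∈ A, (ρ k).toReal * f k| ≤ C * (1 - ∑ k ∈ A, (ρ k).toReal) := by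
  classical
  have h1 : ∑ k ∈ A, (ρ k).toReal * f k = expect ρ fun k => if k ∈ A then f k else 0 := by
    rw [expect, tsum_eq_sum (s := A) fun k hk => by simp [hk]]
    exact Finset.sum_congr rfl fun k hk => by simp [hk]
  have hf' : ∀ k, |if k ∈ A then f k else 0| ≤ |C| := fun k => by
    split_ifs
    · exact (hf k).trans (le_abs_self C)
    · simp
  have hi : ∀ k, |if k ∈ A then (1 : ℝ) else 0| ≤ 1 := fun k => by split_ifs <;> simp
  have hi' : ∀ k, |C * (1 - if k ∈ A then (1 : ℝ) else 0)| ≤ |C| := fun k => by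
    split_ifs <;> simp
  have h2 : C * (1 - ∑ k ∈ A, (ρ k).toReal) =
      expect ρ fun k => C * (1 - if k ∈ A then (1 : ℝ) else 0) := by
    have h3 := expect_add ρ (f := fun _ => (1 : ℝ)) (g := fun k => -1 * if k ∈ A then (1 : ℝ) else 0)
      (C := 1) (D := 1) (fun _ => by simp) fun k => by
        rw [abs_mul]; simpa using hi k
    rw [expect_const_mul, expect_const, expect_ite_mem] at h3
    rw [expect_const_mul]
    congr 1
    rw [sub_eq_add_neg, neg_eq_neg_one_mul, ← h3]
    exact congrArg _ (funext fun k => by ring)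
  rw [h1, h2, abs_le]
  have h4 := expect_add ρ hf' hi'
  have h5 := expect_add ρ hf hi'
  have h6 : ∀ k, |(if k ∈ A then f k else 0) + C * (1 - if k ∈ A then (1 : ℝ) else 0)| ≤
    |C| + |C| := fun k => (abs_add_le _ _).trans (add_le_add (hf' k) (hi' k))
  have h7 : ∀ k, |f k + C * (1 - if k ∈ A then (1 : ℝ) else 0)| ≤
    C + |C| := fun k => (abs_add_le _ _).trans (add_le_add (hf k) (hi' k))
  have h8 := expect_mono ρ hf h6 fun k => by
    have := abs_le.1 (hf k)
    split_ifs <;> linarith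
  have h9 := expect_mono ρ hf' h7 fun k => by
    have := abs_le.1 (hf k)
    split_ifs <;> linarith
  constructor <;> linarith

/-! ### Membership in the class -/

theorem abs_baseGame_le (i h c : Fin 2) : |baseGame i h c| ≤ 3 := by
  fin_cases i <;> fin_cases h <;> fin_cases c <;> norm_num [baseGame]

theorem abs_anomalousGame_le (k : K) (s : (anomalousGame K).S) (t : (anomalousGame K).T) :
    |(anomalousGame K).g k s t| ≤ 3 :=
  abs_baseGame_le _ _ _

/-- The action `(X, h)` of P1. -/
def rowAction (X : Finset K) (h : Fin 2) : (anomalousGame K).S := (X, h)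

/-- The action `(Y, f)` of P2. -/
def columnAction (Y : Finset K) (f : {A : Finset K // A ⊆ Y} → Fin 2) : (anomalousGame K).T := ⟨Y, f⟩

theorem rowAction_eta (s : (anomalousGame K).S) : rowAction s.1 s.2 = s := rfl

theorem rowAction_injective {X X' : Finset K} {h h' : Fin 2}
    (e : rowAction X h = rowAction X' h') : X = X' ∧ h = h' :=
  Prod.mk.inj e

open Classical in
theorem g_rowAction (k : K) (X : Finset K) (h : Fin 2) (t : (anomalousGame K).T) :
    (anomalousGame K).g k (rowAction X h) t =
      baseGame (chi X k) h (t.2 ⟨X ∩ t.1, Finset.inter_subset_right⟩) :=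
  rfl

open Classical in
theorem g_columnAction (k : K) (s : (anomalousGame K).S) (Y : Finset K)
    (f : {A : Finset K // A ⊆ Y} → Fin 2) : (anomalousGame K).g k s (columnAction Y f) =
      baseGame (chi s.1 k) s.2 (f ⟨s.1 ∩ Y, Finset.inter_subset_right⟩) :=
  rfl

instance : Nonempty (anomalousGame K).S := ⟨rowAction ∅ 0⟩

instance : Nonempty (anomalousGame K).T := ⟨columnAction ∅ fun _ => 0⟩

open Classical in
/-- The trace of an action of P1 on a finite set of states. -/
noncomputable def restrictAction (A : Finset K) (s : (anomalousGame K).S) : (anomalousGame K).S :=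
  rowAction (s.1 ∩ A) s.2

open Classical in
/-- The reply of P2 that only looks at the trace of P1's action on a finite set of states. -/
noncomputable def restrictReply (A : Finset K) (t : (anomalousGame K).T) : (anomalousGame K).T :=
  columnAction (t.1 ∩ A) fun B => t.2 ⟨B.1, B.2.trans Finset.inter_subset_left⟩

/-- By truncating his replies to `A`, P2 in effect truncates P1's actions, of which only finitely
many then matter. -/
theorem g_restrictReply {A : Finset K} {k : K} (hk : k ∈ A) (s : (anomalousGame K).S)
    (t : (anomalousGame K).T) : (anomalousGame K).g k s (restrictReply A t) =
      (anomalousGame K).g k (restrictAction A s) t := by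
  classical
  have h1 : chi (restrictAction A s).1 k = chi s.1 k := by
    simp [chi, restrictAction, rowAction, hk]
  have h2 : ∀ B B' : {B // B ⊆ t.1}, B.1 = B'.1 → t.2 B = t.2 B' := fun B B' h => by
    rw [Subtype.ext h]
  simp only [anomalousGame, h1]
  congr 1
  refine h2 _ _ ?_
  ext x
  simp only [restrictAction, restrictReply, rowAction, columnAction, Finset.mem_inter]
  tauto

theorem exists_nearly_optimal (ρ : PMF K) (N : ℕ) {ε : ℝ} (hε : 0 < ε) :
    ∃ σ τ, ∀ σ' τ', (anomalousGame K).payoff ρ N σ' τ ≤ (anomalousGame K).payoff ρ N σ τ' + ε := by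
  classical
  -- Payoffs are bounded by `3` per stage, so dropping the states outside `A` costs at most `ε / 3`.
  -- This is paid twice, once for each side, and the minimax theorem takes the last third.
  obtain ⟨A, hA⟩ := exists_finset_one_sub_lt ρ (show 0 < ε / (3 * (N * 3 + 1)) by positivity)
  have hC := abs_anomalousGame_le (K := K)
  have htr : ∀ σ τ, |(anomalousGame K).payoff ρ N σ τ -
      ∑ k ∈ A, (ρ k).toReal * (anomalousGame K).stateGain k N (σ k) τ| ≤ ε / 3 := fun σ τ => by
    rw [Collection.payoff_eq_expect hC]
    refine (abs_expect_sub_sum_le ρ A fun k => Collection.abs_stateGain_le hC k N (σ k) τ).trans ?_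
    calc (N : ℝ) * 3 * (1 - ∑ k ∈ A, (ρ k).toReal)
        ≤ (N * 3 + 1) * (ε / (3 * (N * 3 + 1))) := by
          refine mul_le_mul (by linarith) (by linarith) ?_ (by positivity)
          rw [sub_nonneg, ← (hasSum_toReal ρ).tsum_eq]
          exact (hasSum_toReal ρ).summable.sum_le_tsum _ fun _ _ => ENNReal.toReal_nonneg
      _ = ε / 3 := by field_simp
  -- `N + 1` coordinates make `Fin.ofNat` available when `N = 0`; the last one is never used in `N`
  -- stages.
  let D := Fin (N + 1) → A.powerset × Fin 2
  let path : D → ℕ → (anomalousGame K).S := fun d n =>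
    rowAction (d (Fin.ofNat (N + 1) n)).1.1 (d (Fin.ofNat (N + 1) n)).2
  let p : (A → D) → K → ℕ → (anomalousGame K).S := fun a k =>
    if hk : k ∈ A then path (a ⟨k, hk⟩) else fun _ => Classical.arbitrary _
  have : Nonempty (A.powerset × Fin 2) := ⟨⟨∅, Finset.empty_mem_powerset A⟩, 0⟩
  have hpg : ∀ k b q, |(anomalousGame K).pathGain k N b q| ≤ N * 3 := fun k =>
    Collection.abs_pathGain_le hC k N
  have hpb : ∀ k b q, |(ρ k).toReal * (anomalousGame K).pathGain k N b q| ≤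
      (ρ k).toReal * (N * 3) := fun k b q => by
    rw [abs_mul, abs_of_nonneg ENNReal.toReal_nonneg]
    exact mul_le_mul_of_nonneg_left (hpg k b q) ENNReal.toReal_nonneg
  obtain ⟨c, ν, hc0, hc1, hcν⟩ := exists_minimax
    (fun (a : A → D) (b : List (anomalousGame K).S → (anomalousGame K).T) =>
      ∑ k ∈ A, (ρ k).toReal * (anomalousGame K).pathGain k N (fun z => PMF.pure (b z)) (p a k))
    (fun a b => (Finset.abs_sum_le_sum_abs _ _).trans (Finset.sum_le_sum fun k _ => hpb k _ _))
    (show 0 < ε / 3 by positivity)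
  obtain ⟨σ, hσ⟩ := Collection.exists_strategy_of_mixture hC A N (fun i k => c i * (ρ k).toReal)
    (fun i k => mul_nonneg (hc0 i) ENNReal.toReal_nonneg) p
  let β : List (anomalousGame K).S → PMF (anomalousGame K).T := fun z =>
    ν.map fun b => restrictReply A (b (z.map (restrictAction A)))
  -- A best path against `ν` chosen in each state is itself one of P1's plans, so `hcν` covers P1's
  -- best reply.
  choose d hd using fun k => Finite.exists_max fun d : D =>
    (anomalousGame K).pathGain k N (fun z => ν.map fun b => b z) (path d)
  have hβ : ∀ k ∈ A, ∀ q, (anomalousGame K).pathGain k N β q ≤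
      (anomalousGame K).pathGain k N (fun z => ν.map fun b => b z) (path (d k)) := by
    intro k hk q
    refine le_trans (le_of_eq ?_) (hd k fun n => (⟨(restrictAction A (q n)).1, by
      simp [restrictAction, rowAction]⟩, (restrictAction A (q n)).2))
    refine Collection.pathGain_congr (r := restrictAction A) (fun n hn => ?_) fun z n hn => ?_
    · simp [path, Fin.ofNat, rowAction_eta, Nat.mod_eq_of_lt (show n < N + 1 by omega)]
    · rw [expect_map _ _ (hC k (q n)), expect_map _ _ (hC k _)]
      simp only [g_restrictReply hk]
      simp [path, Fin.ofNat, rowAction_eta, Nat.mod_eq_of_lt (show n < N + 1 by omega)]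
  refine ⟨σ, fun h => β (h.map Prod.fst), fun σ' τ' => ?_⟩
  obtain ⟨b, hb⟩ := hσ τ'
  have h1 := (abs_le.1 (htr σ' fun h => β (h.map Prod.fst))).2
  have h2 := (abs_le.1 (htr σ τ')).1
  have h3 : ∑ k ∈ A, (ρ k).toReal *
      (anomalousGame K).stateGain k N (σ' k) (fun h => β (h.map Prod.fst)) ≤
      expect ν fun b => ∑ k ∈ A, (ρ k).toReal *
        (anomalousGame K).pathGain k N (fun z => PMF.pure (b z)) (p (fun k => d k) k) := by
    rw [expect_sum _ _ fun k _ b => hpb k _ _]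
    refine Finset.sum_le_sum fun k hk => ?_
    rw [expect_const_mul, ← Collection.pathGain_map hC k N ν fun b => b]
    refine mul_le_mul_of_nonneg_left ?_ ENNReal.toReal_nonneg
    refine Collection.stateGain_le_of_pathGain_le hC k N β _ ?_
    simpa [p, hk] using hβ k hk
  have h4 := hcν (fun k => d k) b
  have h5 : ∑ a, c a * ∑ k ∈ A, (ρ k).toReal *
      (anomalousGame K).pathGain k N (fun z => PMF.pure (b z)) (p a k) =
      ∑ k ∈ A, ∑ a, c a * (ρ k).toReal *
        (anomalousGame K).pathGain k N (fun z => PMF.pure (b z)) (p a k) := by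
    rw [Finset.sum_comm]
    simp only [Finset.mul_sum, mul_assoc]
  simp only [← Finset.sum_mul, hc1, one_mul] at hb
  linarith

/-! ### The non-revealing one-stage game. -/

theorem baseGame_chi [DecidableEq K] (X : Finset K) (k : K) (h c : Fin 2) :
    baseGame (chi X k) h c = (if h = 0 then 1 else -1) *
      ((if c = 0 then 3 else -1) - if k ∈ X then 1 else 0) := by
  by_cases hk : k ∈ X <;> fin_cases h <;> fin_cases c <;> norm_num [baseGame, chi, hk]

theorem payoffNR_eq (ρ : PMF K) (σ : (anomalousGame K).Hist → PMF (anomalousGame K).S)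
    (τ : (anomalousGame K).Strategy2) : (anomalousGame K).payoffNR ρ σ τ =
      expect ρ fun k => expect (σ []) fun s => expect (τ []) fun t => (anomalousGame K).g k s t := by
  rw [Collection.payoffNR, Collection.payoff_eq_expect abs_anomalousGame_le]
  simp [Collection.stateGain]

/-- P1's fair `h` with `X = ∅` gives zero in every state. P2 mixes the replies constantly `0`,
constantly `1`, and "is `j ∈ X ∩ A`?" with `j` drawn from `ρ`: the mean of `e` is `3/4 - 1/2 + (4
ρ(X ∩ A) - 1)/4 = ρ(X ∩ A)`, which offsets `ρ(X)` up to the mass outside `A`. -/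
theorem isValue_payoffNR (ρ : PMF K) : IsValue ((anomalousGame K).payoffNR ρ) 0 := by
  classical
  intro ε hε
  have hC := abs_anomalousGame_le (K := K)
  obtain ⟨A, hA⟩ := exists_finset_one_sub_lt ρ hε
  obtain ⟨q, hq⟩ := exists_mixture (fun _ : Fin 2 => 1 / 2) (fun _ => by norm_num) (by norm_num)
    fun h => PMF.pure (rowAction (K := K) ∅ h)
  let z : Fin 2 → (anomalousGame K).T := fun c => columnAction A fun _ => c
  obtain ⟨r, hr⟩ := exists_mixture ![1 / 4, 1 / 2, 1 / 4]
    (fun i => by fin_cases i <;> norm_num) (by simp [Fin.sum_univ_three]; norm_num)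
    ![PMF.pure (z 0), PMF.pure (z 1),
      ρ.map fun j => (columnAction A fun B => if j ∈ B.1 then 0 else 1)]
  refine ⟨fun _ => q, fun _ => r, fun τ => ?_, fun σ => ?_⟩
  · rw [payoffNR_eq]
    have : ∀ k, (expect q fun s => expect (τ []) fun t => (anomalousGame K).g k s t) = 0 := by
      intro k
      rw [hq _ 3 fun s => abs_expect_le _ (hC k s)]
      have h : (expect (τ []) fun t => (anomalousGame K).g k (rowAction ∅ 1) t) =
          -1 * expect (τ []) fun t => (anomalousGame K).g k (rowAction ∅ 0) t := by
        rw [← expect_const_mul]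
        refine congrArg _ (funext fun t => ?_)
        simp [g_rowAction, baseGame_chi]
      simp only [expect_pure, Fin.sum_univ_two, h]
      ring
    simp only [this, expect_const]
    linarith
  · rw [payoffNR_eq, expect_comm (C := 3) _ _ fun k s => abs_expect_le _ (hC k s), zero_add]
    refine expect_le _ (fun s => abs_expect_le _ fun k => abs_expect_le _ (hC k s)) fun s => ?_
    have hi : ∀ (B : Finset K) k, |if k ∈ B then (1 : ℝ) else 0| ≤ 1 := fun B k => by
      split_ifs <;> simp
    have hrt : ∀ k, expect r (fun t => (anomalousGame K).g k s t) = (if s.2 = 0 then 1 else -1) *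
        (∑ j ∈ s.1 ∩ A, (ρ j).toReal + -1 * if k ∈ s.1 then 1 else 0) := fun k => by
      rw [hr _ 3 (hC k s), Fin.sum_univ_three]
      simp only [Matrix.cons_val_zero, Matrix.cons_val_one, Matrix.cons_val, expect_pure]
      rw [expect_map _ _ (hC k s)]
      simp only [z, g_columnAction, baseGame_chi]
      have hfun : ∀ j, ((if s.2 = 0 then 1 else -1) *
          ((if (if j ∈ s.1 ∩ A then (0 : Fin 2) else 1) = 0 then 3 else -1) -
            if k ∈ s.1 then 1 else 0) : ℝ) =
          (if s.2 = 0 then 1 else -1) * (-1 - if k ∈ s.1 then 1 else 0) +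
            ((if s.2 = 0 then 1 else -1) * 4) * if j ∈ s.1 ∩ A then 1 else 0 := fun j => by
        split_ifs <;> norm_num at *
      have hexp := expect_add (C := |(if s.2 = 0 then 1 else -1) *
          (-1 - if k ∈ s.1 then 1 else 0)|) (D := 4) ρ (fun _ => le_rfl)
        (g := fun j => ((if s.2 = 0 then 1 else -1) * 4) * if j ∈ s.1 ∩ A then 1 else 0)
        fun j => by split_ifs <;> norm_num
      rw [expect_const, expect_const_mul, expect_ite_mem] at hexp
      simp only [← hfun] at hexp
      -- Only the decidability instance behind `∩` has to be reconciled.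
      have hexp' := fun I => Eq.trans (congrArg (fun I : DecidableEq K => expect ρ fun j =>
        ((if s.2 = 0 then 1 else -1) *
          ((if (if j ∈ s.1 ∩ A then (0 : Fin 2) else 1) = 0 then 3 else -1) -
            if k ∈ s.1 then 1 else 0) : ℝ)) (Subsingleton.elim I _)) hexp
      rw [hexp']
      simp only [if_true, one_ne_zero, if_false]
      ring
    simp only [hrt]
    rw [expect_const_mul, expect_add (C := |∑ j ∈ s.1 ∩ A, (ρ j).toReal|) (D := 1) _
      (fun _ => le_rfl) (fun k => by rw [abs_mul]; simpa using hi s.1 k), expect_const,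
      expect_const_mul, expect_ite_mem]
    have h1 := Finset.sum_inter_add_sum_sdiff s.1 A fun j => (ρ j).toReal
    have h2 := Finset.sum_union (f := fun j => (ρ j).toReal)
      (Finset.sdiff_disjoint : Disjoint (s.1 \ A) A)
    have h3 := (hasSum_toReal ρ).summable.sum_le_tsum (s.1 \ A ∪ A)
      fun _ _ => ENNReal.toReal_nonneg
    have h4 : 0 ≤ ∑ j ∈ s.1 \ A, (ρ j).toReal :=
      Finset.sum_nonneg fun _ _ => ENNReal.toReal_nonneg
    rw [(hasSum_toReal ρ).tsum_eq] at h3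
    split_ifs <;> linarith

theorem inClass_anomalousGame [Countable K] : InClass (anomalousGame K) where
  countable_S := inferInstanceAs (Countable (Finset K × Fin 2))
  countable_T := by
    classical
    have : ∀ Y : Finset K, Finite {A : Finset K // A ⊆ Y} := fun Y =>
      Finite.of_injective (fun A => (⟨A.1, Finset.mem_powerset.2 A.2⟩ : Y.powerset))
        fun A B h => Subtype.ext (Subtype.mk.inj h)
    exact inferInstanceAs (Countable (Σ Y : Finset K, ({A : Finset K // A ⊆ Y} → Fin 2)))
  bounded := ⟨3, abs_anomalousGame_le⟩
  hasValue ρ N := exists_isValue fun _ hε => exists_nearly_optimal ρ N hε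
  valueNR := isValue_payoffNR

/-! ### Gradual revelation by P1 -/

/-- P1 draws `i` from its conditional law given the state, plays `act i` and continues by `cont`. As
`cont (act i)` guarantees `c i` at `ν i` against every continuation of P2, stage gain and
continuation add up. -/
theorem Collection.exists_strategy_of_splitting {Γ : Collection K} [Nonempty Γ.S] {C : ℝ}
    (hC : ∀ k s t, |Γ.g k s t| ≤ C) {ι : Type*} [Fintype ι] (w : ℝ) (μ : PMF K) (a : ι → ℝ)
    (h0 : ∀ i, 0 ≤ a i) (ν : ι → PMF K) (hμ : ∀ k, w * (μ k).toReal = ∑ i, a i * (ν i k).toReal)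
    (N : ℕ) (act : ι → Γ.S) (cont : Γ.S → Γ.Strategy1) (c : ι → ℝ)
    (hc : ∀ i τ, c i ≤ Γ.payoff (ν i) N (cont (act i)) τ) (d : ℝ)
    (hd : ∀ t, d ≤ ∑ i, a i * expect (ν i) fun k => Γ.g k (act i) t) :
    ∃ σ, ∀ τ, d + ∑ i, a i * c i ≤ w * Γ.payoff μ (N + 1) σ τ := by
  obtain ⟨σ, hσ⟩ := exists_strategy_step hC (fun i k => a i * (ν i k).toReal)
    (fun i k => mul_nonneg (h0 i) ENNReal.toReal_nonneg) (fun i _ => act i) cont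
  refine ⟨σ, fun τ => ?_⟩
  let Ψ : ι → K → Γ.T → ℝ := fun i k t => Γ.g k (act i) t +
    Γ.stateGain k N (cont (act i) k) fun h => τ ((act i, t) :: h)
  have hΨ : ∀ i k t, |Ψ i k t| ≤ (N + 1) * C := fun i k t =>
    abs_gain_add_stateGain_le hC _ _ _ _ _ _
  have hterm : ∀ k, w * ((μ k).toReal * Γ.stateGain k (N + 1) (σ k) τ) =
      ∑ i, a i * ((ν i k).toReal * expect (τ []) (Ψ i k)) := fun k => by
    rw [← mul_assoc, hμ, hσ k N τ, expect_sum _ _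
      (C := fun i => a i * (ν i k).toReal * ((N + 1) * C)) fun i _ t => ?_]
    · exact Finset.sum_congr rfl fun i _ => by rw [expect_const_mul, mul_assoc]
    · have h := mul_nonneg (h0 i) (ENNReal.toReal_nonneg (a := ν i k))
      rw [abs_mul, abs_of_nonneg h]
      exact mul_le_mul_of_nonneg_left (hΨ i k t) h
  have hpay : w * Γ.payoff μ (N + 1) σ τ =
      expect (τ []) fun t => ∑ i, a i * expect (ν i) fun k => Ψ i k t := by
    rw [payoff_eq_expect hC, expect, ← tsum_mul_left]
    simp only [hterm]
    rw [Summable.tsum_finsetSum fun i _ =>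
      (summable_expect (ν i) fun k => abs_expect_le _ (hΨ i k)).mul_left _,
      expect_sum _ _ (C := fun i => a i * ((N + 1) * C)) fun i _ t => ?_]
    · refine Finset.sum_congr rfl fun i _ => ?_
      rw [tsum_mul_left, expect_const_mul, ← expect_comm _ _ (hΨ i)]
      rfl
    · rw [abs_mul, abs_of_nonneg (h0 i)]
      exact mul_le_mul_of_nonneg_left (abs_expect_le _ fun k => hΨ i k t) (h0 i)
  rw [hpay]
  refine le_expect _ (C := ∑ i, a i * ((N + 1) * C)) (fun t => ?_) fun t => ?_
  · refine (Finset.abs_sum_le_sum_abs _ _).trans (Finset.sum_le_sum fun i _ => ?_)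
    rw [abs_mul, abs_of_nonneg (h0 i)]
    exact mul_le_mul_of_nonneg_left (abs_expect_le _ fun k => hΨ i k t) (h0 i)
  · refine (add_le_add_left (hd t) _).trans ?_
    rw [← Finset.sum_add_distrib]
    refine Finset.sum_le_sum fun i _ => ?_
    rw [← mul_add]
    refine mul_le_mul_of_nonneg_left ?_ (h0 i)
    simp only [Ψ]
    rw [expect_add _ (fun k => hC k _ t) fun k => abs_stateGain_le hC _ _ _ _,
      ← payoff_eq_expect hC]
    linarith [hc i fun h => τ ((act i, t) :: h)]

theorem summable_tvDist (p q : PMF K) : Summable fun k => |(p k).toReal - (q k).toReal| :=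
  ((hasSum_toReal p).summable.sub (hasSum_toReal q).summable).abs

/-- The total variation is twice the largest excess of one measure over the other. -/
theorem exists_tvDist_le (p q : PMF K) {ε : ℝ} (hε : 0 < ε) :
    ∃ X : Finset K, tvDist p q / 2 - ε ≤ ∑ k ∈ X, (q k).toReal - ∑ k ∈ X, (p k).toReal := by
  classical
  -- `(|p - q| + q - p) / 2` is the positive part of `q - p`, and it sums to `tvDist p q / 2`.
  have h := (((summable_tvDist p q).hasSum.add
    ((hasSum_toReal q).sub (hasSum_toReal p))).div_const 2)
  obtain ⟨A, hA⟩ := (h.eventually_const_lt (show tvDist p q / 2 - ε < _ by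
    rw [← tvDist]; linarith)).exists
  refine ⟨A.filter fun k => (p k).toReal ≤ (q k).toReal, hA.le.trans (le_of_eq ?_)⟩
  rw [← Finset.sum_sub_distrib, Finset.sum_filter]
  refine Finset.sum_congr rfl fun k _ => ?_
  beta_reduce
  split_ifs with hk
  · rw [abs_of_nonpos (by linarith)]; ring
  · rw [abs_of_nonneg (by linarith)]; ring

theorem mul_tvDist_eq {w w' : ℝ} (hw : 0 ≤ w) (hw' : 0 ≤ w') {p q p' q' : PMF K}
    (h : ∀ k, w * ((p k).toReal - (q k).toReal) = w' * ((p' k).toReal - (q' k).toReal)) :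
    w * tvDist p q = w' * tvDist p' q' := by
  rw [tvDist, tvDist, ← tsum_mul_left, ← tsum_mul_left]
  refine tsum_congr fun k => ?_
  rw [← abs_of_nonneg hw, ← abs_mul, h, abs_mul, abs_of_nonneg hw']

theorem tvDist_comm (p q : PMF K) : tvDist p q = tvDist q p :=
  tsum_congr fun _ => abs_sub_comm _ _

theorem exists_strategy_of_split_of_le {w₀ w₁ : ℝ} (h0 : 0 ≤ w₀) (h01 : w₀ ≤ w₁) (μ μ₀ μ₁ : PMF K)
    (hμ : ∀ k, (w₀ + w₁) * (μ k).toReal = w₀ * (μ₀ k).toReal + w₁ * (μ₁ k).toReal) (N : ℕ)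
    (σ₀ σ₁ : (anomalousGame K).Strategy1) (c₀ c₁ : ℝ)
    (hσ₀ : ∀ τ, c₀ ≤ (anomalousGame K).payoff μ₀ N σ₀ τ)
    (hσ₁ : ∀ τ, c₁ ≤ (anomalousGame K).payoff μ₁ N σ₁ τ) {ε : ℝ} (hε : 0 < ε) :
    ∃ σ, ∀ τ, (w₀ * tvDist μ₀ μ + w₁ * tvDist μ₁ μ) / 4 - w₀ * ε + (w₀ * c₀ + w₁ * c₁) ≤
      (w₀ + w₁) * (anomalousGame K).payoff μ (N + 1) σ τ := by
  classical
  obtain ⟨X, hX⟩ := exists_tvDist_le μ₀ μ₁ hε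
  obtain ⟨k₀, -⟩ := μ.support_nonempty
  -- Playing `X'` must not be mistaken for `(X, 0)`, the only action after which `σ₀` is followed.
  obtain ⟨X', hX'⟩ : ∃ X' : Finset K, X' ≠ X := by
    by_cases h : X = ∅
    · exact ⟨{k₀}, by simp [h]⟩
    · exact ⟨∅, fun e => h e.symm⟩
  have hC := abs_anomalousGame_le (K := K)
  have hexp : ∀ (Z : Finset K) (t : (anomalousGame K).T), ∃ e : ℝ, ∀ (ν : PMF K) (h : Fin 2),
      expect ν (fun k => (anomalousGame K).g k (rowAction Z h) t) =
        (if h = 0 then 1 else -1) * (e - ∑ k ∈ Z, (ν k).toReal) := fun Z t => by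
    obtain ⟨e, he⟩ : ∃ e : ℝ, ∀ k h, (anomalousGame K).g k (rowAction Z h) t =
        (if h = 0 then 1 else -1) * (e - if k ∈ Z then 1 else 0) :=
      ⟨_, fun k h => (g_rowAction k Z h t).trans (baseGame_chi Z k h _)⟩
    refine ⟨e, fun ν h => ?_⟩
    simp only [he]
    have hneg : ∀ k, (e - if k ∈ Z then 1 else 0) = e + -1 * if k ∈ Z then 1 else 0 := fun k => by
      ring
    simp only [hneg]
    rw [expect_const_mul, expect_add (D := 1) _ (fun _ => le_rfl)
      (fun k => by split_ifs <;> simp), expect_const, expect_const_mul, expect_ite_mem]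
    ring
  obtain ⟨σ, hσ⟩ := Collection.exists_strategy_of_splitting hC (w₀ + w₁) μ
    ![w₀, w₀, (w₁ - w₀) / 2, (w₁ - w₀) / 2]
    (fun i => by fin_cases i <;> simp <;> linarith) ![μ₀, μ₁, μ₁, μ₁]
    (fun k => by simp [Fin.sum_univ_four, hμ]; ring) N
    ![rowAction X 0, rowAction X 1, rowAction X' 0, rowAction X' 1]
    (fun s => if s = rowAction X 0 then σ₀ else σ₁) ![c₀, c₁, c₁, c₁]
    (fun i τ => by
      have h1 : rowAction X 1 ≠ rowAction X 0 := fun e => one_ne_zero (rowAction_injective e).2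
      have h2 : ∀ h, rowAction X' h ≠ rowAction X 0 := fun h e => hX' (rowAction_injective e).1
      fin_cases i <;> simp [h1, h2, hσ₀, hσ₁])
    (w₀ * (tvDist μ₀ μ₁ / 2 - ε)) (fun t => by
      obtain ⟨e, he⟩ := hexp X t
      obtain ⟨e', he'⟩ := hexp X' t
      refine (mul_le_mul_of_nonneg_left hX h0).trans (le_of_eq ?_)
      simp [Fin.sum_univ_four, he, he']
      ring)
  refine ⟨σ, fun τ => le_trans ?_ (hσ τ)⟩
  -- Since `μ` is the barycentre, `μ₀ - μ` and `μ₁ - μ` are proportional to `μ₀ - μ₁`.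
  have e0 : (w₀ + w₁) * tvDist μ₀ μ = w₁ * tvDist μ₀ μ₁ :=
    mul_tvDist_eq (by linarith) (by linarith) fun k => by linarith [hμ k]
  have e1 : (w₀ + w₁) * tvDist μ₁ μ = w₀ * tvDist μ₁ μ₀ :=
    mul_tvDist_eq (by linarith) h0 fun k => by linarith [hμ k]
  rw [tvDist_comm μ₁ μ₀] at e1
  have hT := tvDist_nonneg μ₀ μ₁
  have hmain : w₀ * tvDist μ₀ μ + w₁ * tvDist μ₁ μ ≤ 2 * (w₀ * tvDist μ₀ μ₁) := by
    rcases (show 0 ≤ w₀ + w₁ by linarith).eq_or_lt with hs | hs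
    · obtain rfl : w₀ = 0 := by linarith
      obtain rfl : w₁ = 0 := by linarith
      simp
    · refine le_of_mul_le_mul_left ?_ hs
      calc (w₀ + w₁) * (w₀ * tvDist μ₀ μ + w₁ * tvDist μ₁ μ)
          = w₀ * ((w₀ + w₁) * tvDist μ₀ μ) + w₁ * ((w₀ + w₁) * tvDist μ₁ μ) := by ring
        _ = 2 * (w₀ * tvDist μ₀ μ₁) * w₁ := by rw [e0, e1]; ring
        _ ≤ 2 * (w₀ * tvDist μ₀ μ₁) * (w₀ + w₁) :=
          mul_le_mul_of_nonneg_left (by linarith) (by positivity)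
        _ = _ := by ring
  simp only [Fin.sum_univ_four, Matrix.cons_val]
  linarith

theorem exists_strategy_of_split {w₀ w₁ : ℝ} (h0 : 0 ≤ w₀) (h1 : 0 ≤ w₁) (μ μ₀ μ₁ : PMF K)
    (hμ : ∀ k, (w₀ + w₁) * (μ k).toReal = w₀ * (μ₀ k).toReal + w₁ * (μ₁ k).toReal) (N : ℕ)
    (σ₀ σ₁ : (anomalousGame K).Strategy1) (c₀ c₁ : ℝ)
    (hσ₀ : ∀ τ, c₀ ≤ (anomalousGame K).payoff μ₀ N σ₀ τ)
    (hσ₁ : ∀ τ, c₁ ≤ (anomalousGame K).payoff μ₁ N σ₁ τ) {ε : ℝ} (hε : 0 < ε) :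
    ∃ σ, ∀ τ, (w₀ * tvDist μ₀ μ + w₁ * tvDist μ₁ μ) / 4 - (w₀ + w₁) * ε + (w₀ * c₀ + w₁ * c₁) ≤
      (w₀ + w₁) * (anomalousGame K).payoff μ (N + 1) σ τ := by
  rcases le_total w₀ w₁ with h | h
  · obtain ⟨σ, hσ⟩ := exists_strategy_of_split_of_le h0 h μ μ₀ μ₁ hμ N σ₀ σ₁ c₀ c₁ hσ₀ hσ₁ hε
    exact ⟨σ, fun τ => le_trans (by nlinarith) (hσ τ)⟩
  · obtain ⟨σ, hσ⟩ := exists_strategy_of_split_of_le h1 h μ μ₁ μ₀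
      (fun k => by rw [add_comm, hμ, add_comm]) N σ₁ σ₀ c₁ c₀ hσ₁ hσ₀ hε
    exact ⟨σ, fun τ => le_trans (by nlinarith) ((hσ τ).trans (by rw [add_comm]))⟩

/-! ### Trees of posteriors -/

/-- The variation over `N` steps of a tree of measures `m` with weights `w`, starting at the
node `z`. -/
noncomputable def treeVariation {D : ℕ} (w : List (Fin D) → ℝ) (m : List (Fin D) → PMF K) :
    ℕ → List (Fin D) → ℝ
  | 0, _ => 0
  | N + 1, z => ∑ i, (w (i :: z) * tvDist (m (i :: z)) (m z) + treeVariation w m N (i :: z))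

theorem exists_strategy_of_tree (w : List (Fin 2) → ℝ) (m : List (Fin 2) → PMF K)
    (hw0 : ∀ z, 0 ≤ w z) (hw : ∀ z, w z = ∑ i, w (i :: z))
    (hm : ∀ z k, w z * (m z k).toReal = ∑ i, w (i :: z) * (m (i :: z) k).toReal) {ε : ℝ}
    (hε : 0 < ε) (N : ℕ) (z : List (Fin 2)) :
    ∃ (c : ℝ) (σ : (anomalousGame K).Strategy1),
      treeVariation w m N z / 4 - w z * (N * ε) ≤ w z * c ∧
        ∀ τ, c ≤ (anomalousGame K).payoff (m z) N σ τ := by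
  have hC := abs_anomalousGame_le (K := K)
  induction N generalizing z with
  | zero =>
    refine ⟨0, fun _ _ => PMF.pure (Classical.arbitrary _), by simp [treeVariation], fun τ => ?_⟩
    simp [Collection.payoff_eq_expect hC, Collection.stateGain]
  | succ N ih =>
    obtain ⟨c₀, σ₀, h₀, hσ₀⟩ := ih (0 :: z)
    obtain ⟨c₁, σ₁, h₁, hσ₁⟩ := ih (1 :: z)
    have hwz := hw z
    have hmz := hm z
    simp only [Fin.sum_univ_two] at hwz hmz
    simp only [treeVariation, Fin.sum_univ_two, hwz]
    rw [hwz] at hmz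
    obtain ⟨σ, hσ⟩ := exists_strategy_of_split (hw0 (0 :: z)) (hw0 (1 :: z)) (m z) _ _ hmz N
      σ₀ σ₁ c₀ c₁ hσ₀ hσ₁ hε
    rcases (add_nonneg (hw0 (0 :: z)) (hw0 (1 :: z))).eq_or_lt with hs | hs
    · have e0 : w (0 :: z) = 0 := by linarith [hw0 (0 :: z), hw0 (1 :: z)]
      have e1 : w (1 :: z) = 0 := by linarith [hw0 (0 :: z), hw0 (1 :: z)]
      rw [e0] at h₀
      rw [e1] at h₁
      -- At a node of weight zero the trivial bound on the payoff suffices.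
      refine ⟨-((N + 1 : ℕ) * 3), σ, ?_, fun τ => ?_⟩
      · rw [e0, e1]
        linarith
      · rw [Collection.payoff_eq_expect hC]
        exact (abs_le.1 (abs_expect_le _ fun k => Collection.abs_stateGain_le hC _ _ _ _)).1
    · refine ⟨((w (0 :: z) * tvDist (m (0 :: z)) (m z) + w (1 :: z) * tvDist (m (1 :: z)) (m z)) / 4
        - (w (0 :: z) + w (1 :: z)) * ε + (w (0 :: z) * c₀ + w (1 :: z) * c₁)) /
          (w (0 :: z) + w (1 :: z)), σ, ?_, fun τ => ?_⟩
      · rw [mul_div_cancel₀ _ hs.ne']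
        push_cast
        linarith
      · rw [div_le_iff₀' hs]
        exact hσ τ

open MeasureTheory

/-! ### The tree of a martingale -/

section Cylinder

variable {Ω : Type*} {D : ℕ} (x : ℕ → Ω → Fin D)

/-- The event that the variables `x 0, x 1, …` start with the entries of `z`, the most recent one
first. -/
def cylinder : List (Fin D) → Set Ω
  | [] => Set.univ
  | i :: z => cylinder z ∩ x z.length ⁻¹' {i}

theorem eq_of_mem_cylinder {z : List (Fin D)} {ω ω' : Ω} (h : ω ∈ cylinder x z)
    (h' : ω' ∈ cylinder x z) : ∀ j < z.length, x j ω = x j ω' := by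
  induction z with
  | nil => simp
  | cons i z ih =>
    intro j hj
    rcases (Nat.lt_succ_iff.1 hj).eq_or_lt with rfl | hj
    · exact h.2.trans h'.2.symm
    · exact ih h.1 h'.1 j hj

end Cylinder

section Past

variable {Ω : Type*} [mΩ : MeasurableSpace Ω] {D : ℕ} (x : ℕ → Ω → Fin D)

theorem pastFiltration_le_comap (hx : ∀ n, Measurable (x n)) (n : ℕ) :
    pastFiltration x hx n ≤ MeasurableSpace.comap (fun ω (j : Fin n) => x j ω) ⊤ := by
  refine iSup_le fun j => iSup_le fun hj => ?_
  have : x j = (fun y : Fin n → Fin D => y ⟨j, hj⟩) ∘ fun ω (j : Fin n) => x j ω := rfl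
  rw [this, ← MeasurableSpace.comap_comp]
  exact MeasurableSpace.comap_mono le_top

/-- Every event of the `n`-th σ-algebra is a preimage under the first `n` variables; the level set
of `f` through `ω` is such an event. -/
theorem eq_of_past_eq {hx : ∀ n, Measurable (x n)} {n : ℕ} {f : Ω → ℝ}
    (hf : Measurable[pastFiltration x hx n] f) {ω ω' : Ω} (h : ∀ j < n, x j ω = x j ω') :
    f ω = f ω' := by
  obtain ⟨s, -, hs⟩ := pastFiltration_le_comap x hx n _ (hf (measurableSet_singleton (f ω)))
  have hω : ω ∈ (fun ω (j : Fin n) => x j ω) ⁻¹' s := by rw [hs]; rfl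
  have hω' : ω' ∈ (fun ω (j : Fin n) => x j ω) ⁻¹' s := by
    rw [Set.mem_preimage] at hω ⊢
    rwa [show (fun j : Fin n => x j ω') = fun j : Fin n => x j ω from
      funext fun j => (h j j.2).symm]
  rw [hs] at hω'
  exact hω'.symm

theorem measurable_of_past (hx : ∀ n, Measurable (x n)) {n : ℕ} {f : Ω → ℝ}
    (hf : ∀ ω ω', (∀ j < n, x j ω = x j ω') → f ω = f ω') : Measurable f := by
  have hF : Function.FactorsThrough f fun ω (j : Fin n) => x j ω := fun ω ω' h =>
    hf ω ω' fun j hj => congrFun h ⟨j, hj⟩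
  obtain ⟨g, rfl⟩ := (Function.factorsThrough_iff f).1 hF
  exact (measurable_of_finite _).comp (measurable_pi_lambda _ fun j => hx j)

theorem measurableSet_cylinder (hx : ∀ n, Measurable (x n)) (z : List (Fin D)) :
    MeasurableSet[pastFiltration x hx z.length] (cylinder x z) := by
  induction z with
  | nil => exact MeasurableSet.univ
  | cons i z ih =>
    refine MeasurableSet.inter ((pastFiltration x hx).mono (Nat.le_succ _) _ ih) ?_
    refine (le_iSup₂ (f := fun j (_ : j < (i :: z).length) => MeasurableSpace.comap (x j) inferInstance)
      z.length (Nat.lt_succ_self _)) _ ⟨{i}, measurableSet_singleton i, rfl⟩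

theorem setIntegral_cylinder (P : Measure Ω) (hx : ∀ n, Measurable (x n)) (z : List (Fin D))
    {f : Ω → ℝ} (hf : Integrable f P) :
    ∫ ω in cylinder x z, f ω ∂P = ∑ i, ∫ ω in cylinder x (i :: z), f ω ∂P := by
  have hm : ∀ z, MeasurableSet (cylinder x z) := fun z =>
    (pastFiltration x hx).le _ _ (measurableSet_cylinder x hx z)
  rw [← integral_iUnion_fintype fun i => hm (i :: z)]
  · congr 2
    ext ω
    simp [cylinder]
  · intro i j hij
    exact Set.disjoint_left.2 fun ω h h' => hij (h.2.symm.trans h'.2)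
  · exact fun i => hf.integrableOn

end Past

namespace MeasureMartingale

variable {D : ℕ} {ρ : PMF K} (M : MeasureMartingale D ρ)

attribute [instance] MeasureMartingale.mΩ MeasureMartingale.isProb

theorem eq_of_past_eq {n : ℕ} {ω ω' : M.Ω} (h : ∀ j < n, M.x j ω = M.x j ω') :
    M.μ n ω = M.μ n ω' := by
  refine PMF.ext fun k => ?_
  have hf := ((M.martingale {k}).stronglyAdapted n).measurable
  have := RepeatedGame.eq_of_past_eq M.x hf h
  simp only [PMF.toOuterMeasure_apply_singleton] at this
  exact (ENNReal.toReal_eq_toReal_iff' ((M.μ n ω).apply_ne_top k) ((M.μ n ω').apply_ne_top k)).1 this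

open Classical in
/-- The value of the martingale on a cylinder. -/
noncomputable def nodeMeasure (z : List (Fin D)) : PMF K :=
  -- The default on an empty cylinder is harmless, as its weight is zero.
  if h : (cylinder M.x z).Nonempty then M.μ z.length h.choose else ρ

theorem nodeMeasure_eq {z : List (Fin D)} {ω : M.Ω} (h : ω ∈ cylinder M.x z) :
    M.μ z.length ω = M.nodeMeasure z := by
  have hne : (cylinder M.x z).Nonempty := ⟨ω, h⟩
  rw [nodeMeasure, dif_pos hne]
  exact M.eq_of_past_eq (eq_of_mem_cylinder M.x h hne.choose_spec)

/-- The probability of a cylinder. -/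
noncomputable def nodeWeight (z : List (Fin D)) : ℝ := M.P.real (cylinder M.x z)

theorem measurableSet_cylinder (z : List (Fin D)) : MeasurableSet (cylinder M.x z) :=
  (pastFiltration M.x M.measurable_x).le _ _ (RepeatedGame.measurableSet_cylinder M.x _ z)

theorem setIntegral_eq {z : List (Fin D)} {f : M.Ω → ℝ} {c : ℝ}
    (h : ∀ ω ∈ cylinder M.x z, f ω = c) :
    ∫ ω in cylinder M.x z, f ω ∂M.P = M.nodeWeight z * c := by
  rw [setIntegral_congr_fun (M.measurableSet_cylinder z) h, setIntegral_const, smul_eq_mul,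
    nodeWeight]

theorem nodeWeight_eq_sum (z : List (Fin D)) :
    M.nodeWeight z = ∑ i, M.nodeWeight (i :: z) := by
  have h := setIntegral_cylinder M.x M.P M.measurable_x z (integrable_const (1 : ℝ))
  simpa [nodeWeight] using h

/-- This is the martingale property integrated over a cylinder. -/
theorem nodeWeight_mul_nodeMeasure (z : List (Fin D)) (k : K) :
    M.nodeWeight z * (M.nodeMeasure z k).toReal =
      ∑ i, M.nodeWeight (i :: z) * (M.nodeMeasure (i :: z) k).toReal := by
  have hk : ∀ (z : List (Fin D)), ∀ ω ∈ cylinder M.x z,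
      ((M.μ z.length ω).toOuterMeasure {k}).toReal = (M.nodeMeasure z k).toReal := fun z ω h => by
    rw [PMF.toOuterMeasure_apply_singleton, M.nodeMeasure_eq h]
  have h := (M.martingale {k}).setIntegral_eq (Nat.le_succ z.length)
    (RepeatedGame.measurableSet_cylinder M.x M.measurable_x z)
  rw [M.setIntegral_eq (hk z), setIntegral_cylinder M.x M.P M.measurable_x z
    ((M.martingale {k}).integrable _)] at h
  rw [h]
  exact Finset.sum_congr rfl fun i _ => M.setIntegral_eq (hk (i :: z))

theorem integrable_tvDist (n : ℕ) :
    Integrable (fun ω => tvDist (M.μ (n + 1) ω) (M.μ n ω)) M.P := by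
  refine Integrable.of_bound (measurable_of_past M.x M.measurable_x (n := n + 1)
    fun ω ω' h => ?_).aestronglyMeasurable 2 (Filter.Eventually.of_forall fun ω => ?_)
  · rw [M.eq_of_past_eq h, M.eq_of_past_eq fun j hj => h j (hj.trans n.lt_succ_self)]
  · rw [Real.norm_of_nonneg (tvDist_nonneg _ _)]
    exact tvDist_le_two _ _

/-- The cylinder is split by the next variable; on each piece the first increment is constant. -/
theorem setIntegral_variation (N : ℕ) (z : List (Fin D)) :
    ∫ ω in cylinder M.x z, ∑ n ∈ Finset.range N,
      tvDist (M.μ (z.length + n + 1) ω) (M.μ (z.length + n) ω) ∂M.P =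
      treeVariation M.nodeWeight M.nodeMeasure N z := by
  induction N generalizing z with
  | zero => simp [treeVariation]
  | succ N ih =>
    have hint : ∀ N n, Integrable (fun ω => ∑ j ∈ Finset.range N,
        tvDist (M.μ (n + j + 1) ω) (M.μ (n + j) ω)) M.P := fun N n =>
      integrable_finsetSum _ fun j _ => M.integrable_tvDist (n + j)
    rw [setIntegral_cylinder M.x M.P M.measurable_x z (hint _ _), treeVariation]
    refine Finset.sum_congr rfl fun i _ => ?_
    rw [← ih (i :: z), ← M.setIntegral_eq (z := i :: z)
      (f := fun ω => tvDist (M.μ (z.length + 1) ω) (M.μ z.length ω)) fun ω h => by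
        rw [← M.nodeMeasure_eq h, ← M.nodeMeasure_eq h.1]; rfl,
      ← integral_add (M.integrable_tvDist _).integrableOn (hint N _).integrableOn]
    refine integral_congr_ae (Filter.Eventually.of_forall fun ω => ?_)
    simp only [Finset.sum_range_succ', List.length_cons]
    rw [add_comm]
    congr 1
    exact Finset.sum_congr rfl fun j _ => by
      rw [show z.length + 1 + j = z.length + (j + 1) by omega]

end MeasureMartingale

/-! ### The lower bound on the value. -/

theorem maxVariation_div_four_le {ρ : PMF K} {N : ℕ} {v : ℝ}
    (hv : IsValue ((anomalousGame K).payoff ρ N) v) : maxVariation 2 N ρ / 4 ≤ v := by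
  have : Nonempty (MeasureMartingale 2 ρ) := nonempty_measureMartingale 2 one_le_two ρ
  rw [div_le_iff₀ (by norm_num)]
  refine ciSup_le fun M => ?_
  refine le_of_forall_pos_le_add fun ε hε => ?_
  -- The `N` stages lose at most `ε / 8` in all and P2's near-optimal `τ` another `ε / 8`;
  -- multiplied by four, this stays within `ε`.
  obtain ⟨c, σ, hc, hσ⟩ := exists_strategy_of_tree M.nodeWeight M.nodeMeasure
    (fun _ => measureReal_nonneg) M.nodeWeight_eq_sum M.nodeWeight_mul_nodeMeasure
    (show 0 < ε / (8 * (N + 1)) by positivity) N []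
  obtain ⟨-, τ, -, hτ⟩ := hv (ε / 8) (by positivity)
  have hw : M.nodeWeight [] = 1 := by simp [MeasureMartingale.nodeWeight, cylinder]
  have hm : M.nodeMeasure [] = ρ := by
    obtain ⟨ω⟩ : Nonempty M.Ω := M.P.nonempty_of_neZero
    rw [← M.nodeMeasure_eq (ω := ω) (show ω ∈ cylinder M.x [] from Set.mem_univ ω)]
    exact M.initial ω
  have hvar := M.setIntegral_variation N []
  simp only [cylinder, setIntegral_univ, List.length_nil, zero_add] at hvar
  have hsmall : N * (ε / (8 * (N + 1))) ≤ ε / 8 := by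
    rw [mul_div_assoc', div_le_div_iff₀ (by positivity) (by norm_num)]
    nlinarith
  rw [hw, one_mul, one_mul, ← hvar] at hc
  rw [hm] at hσ
  have h1 := hσ τ
  have h2 := hτ σ
  rw [MeasureMartingale.variation]
  linarith

end RepeatedGame

theorem mainTheorem2 {K : Type*} [Countable K] :
    RepeatedGame.InClass (RepeatedGame.anomalousGame K) ∧
      ∀ (ρ : PMF K) (N : ℕ), ∃ v : ℝ,
        RepeatedGame.IsValue ((RepeatedGame.anomalousGame K).payoff ρ N) v ∧
          RepeatedGame.maxVariation 2 N ρ / 4 ≤ v :=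
  ⟨RepeatedGame.inClass_anomalousGame, fun ρ N =>
    (RepeatedGame.inClass_anomalousGame.hasValue ρ N).imp fun _ hv =>
      ⟨hv, RepeatedGame.maxVariation_div_four_le hv⟩⟩
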